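/- Let $\mathbf Z=(Z_i)_{i\in\mathbb Z}$ be a process of random elements of a measurable space $\mathcal Z$ on a probability space $(\Omega,\mathcal F,\mathbb P)$, and let $\mathcal F_{-\infty}^{t}=\sigma(Z_i:i\le t)$, $\mathcal F_{t}^{\infty}=\sigma(Z_i:i\ge t)$. For $k\in\mathbb N$ put $$\phi(k)=\sup_{t\in\mathbb Z}\ \sup_{A\in\mathcal F_{-\infty}^{t},\,\mathbb P(A)>0}\ \sup_{B\in\mathcal F_{t+k}^{\infty}}|\mathbb P(B\mid A)-\mathbb P(B)|,\qquad \Phi_n=\sum_{k=1}^n\phi(k),$$ and assume that $\mathbf Z$ is $\phi$-mixing, i.e. $\phi(k)\to0$ as $k\to\infty$ (no rate of decay is assumed). For every $n$ let $h_n:\mathcal Z\to[a_n,b_n]\subset\mathbb R$ be measurable with $\mathbb E[h_n(Z_i)]=\mu_n$ for all $i$, and let $\mathbb P_n(h_n)=\frac1n\sum_{i=1}^n h_n(Z_i)$. Let $l=l_n>0$ be real numbers with $l_n\to\infty$ and $l_n=o(\sqrt n)$, let $[\cdot]$ denote the integer part, and let $m=[n/[l]]$, $B_j=\{(j-1)[l]+1,\dots,j[l]\}$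 for $1\le j\le m$, $\bar H_n=\frac1{m[l]}\sum_{i=1}^{m[l]}h_n(Z_i)$ and $$\hat V_n=\frac1n\sum_{j=1}^m\Big(\sum_{i\in B_j}\big(h_n(Z_i)-\bar H_n\big)\Big)^2 .$$ Let $(\xi_n)$ be any real sequence decreasing to $0$. Then for every $\delta>0$ and every $n\ge1$ such that $[l_n]\ge1$ and $2\log(1/\delta)<m$, $$\mathbb P\Big(|\mathbb P_n(h_n)-\mu_n|\le\tilde\nu_n(\delta)\,(A_\phi+B_\phi)+\frac{n-m[l]}{n}(b_n-a_n)\Big)\ge1-3\delta,$$ where $$\tilde\nu_n(\delta)=\Big(1-\sqrt{\tfrac{2\log(1/\delta)}{m}}\Big)^{-1},\qquad B_\phi=\frac{(3.15[l]+2\Phi_n)(b_n-a_n)\log(1/\delta)}{n},$$ $$A_\phi=\sqrt{2\log(\tfrac1\delta)\,\tfrac1n\hat V_n}+4(b_n-a_n)\Phi_n\sqrt{\frac{2\log(1/\delta)\,m}{n^2}}+\sqrt{\frac{2\log(1/\delta)\,\xi_n}{n^2}} .$$ (For $\delta>1$, where $\log(1/\delta)<0$, the square roots are read as $0$; the claim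 is empty for $\delta\ge1/3$.) -/

import Mathlib

open MeasureTheory ProbabilityTheory Filter Topology

noncomputable section

namespace PhiMixing

/-- The sub-σ-algebra generated by the variables `Z i` with index `i ∈ s`. With `s = Set.Iic n` it
is the past up to time `n`, with `s = Set.Ici n` the future from time `n` on. -/
abbrev sigmaGen {Ω S : Type*} [MeasurableSpace S] (Z : ℤ → Ω → S) (s : Set ℤ) : MeasurableSpace Ω :=
  ⨆ i ∈ s, MeasurableSpace.comap (Z i) inferInstance

/-- The φ-mixing coefficient at lag `k`: the supremum, over all times `t`, all past events `A`
(up to `t`) of positive probability and all future events `B` (from `t + k` on), of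
`|P(B | A) - P(B)|`. All these numbers lie in `[0, 1]`. -/
def coeff {Ω S : Type*} [MeasurableSpace Ω] [MeasurableSpace S]
    (P : Measure Ω) (Z : ℤ → Ω → S) (k : ℕ) : ℝ :=
  sSup {r : ℝ | ∃ (t : ℤ) (A B : Set Ω),
    MeasurableSet[sigmaGen Z (Set.Iic t)] A ∧ 0 < P A ∧
    MeasurableSet[sigmaGen Z (Set.Ici (t + k))] B ∧
    r = |(cond P A).real B - P.real B|}

/-- A two-sided process is φ-mixing if its coefficients tend to zero (at any rate). -/
def IsPhiMixing {Ω S : Type*} [MeasurableSpace Ω] [MeasurableSpace S]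
    (P : Measure Ω) (Z : ℤ → Ω → S) : Prop :=
  Tendsto (coeff P Z) atTop (𝓝 0)

/-- `Φ_n = φ(1) + ⋯ + φ(n)`. -/
def coeffSum {Ω S : Type*} [MeasurableSpace Ω] [MeasurableSpace S]
    (P : Measure Ω) (Z : ℤ → Ω → S) (n : ℕ) : ℝ :=
  ∑ k ∈ Finset.Icc 1 n, coeff P Z k

/-- The average of the first `n` terms `x 1, …, x n`. -/
def avg (x : ℤ → ℝ) (n : ℕ) : ℝ := (1 / (n : ℝ)) * ∑ i ∈ Finset.Icc 1 n, x (i : ℤ)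

/-- The number `m = [n / L]` of full blocks of length `L` inside `{1, …, n}`. -/
def numBlocks (n L : ℕ) : ℕ := n / L

/-- The `j`-th full block `{(j - 1) L + 1, …, j L}`, for `1 ≤ j ≤ m`. -/
def block (L j : ℕ) : Finset ℕ := Finset.Icc ((j - 1) * L + 1) (j * L)

/-- The block empirical long-run variance
`(1 / n) ∑_{j ≤ m} (∑_{i ∈ B_j} (x i - H))²`, where `H` is the average of `x 1, …, x (m L)`. -/
def blockVar (x : ℤ → ℝ) (n L : ℕ) : ℝ :=
  (1 / (n : ℝ)) * ∑ j ∈ Finset.Icc 1 (numBlocks n L),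
    (∑ i ∈ block L j, (x (i : ℤ) - avg x (numBlocks n L * L))) ^ 2

/-- `(1 - √(2 log(1/δ) / m))⁻¹`. -/
def nuTilde (m : ℕ) (δ : ℝ) : ℝ := (1 - √(2 * Real.log (1 / δ) / m))⁻¹

/-- The term `A_φ`; `V` is the block empirical long-run variance, `r` the range `b_n - a_n`,
`Φ` the sum of the mixing coefficients and `ξ` the free parameter `ξ_n`. -/
def termA (V r Φ ξ δ : ℝ) (n m : ℕ) : ℝ :=
  √(2 * Real.log (1 / δ) * (1 / (n : ℝ)) * V)
    + 4 * r * Φ * √(2 * Real.log (1 / δ) * m / (n : ℝ) ^ 2)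
    + √(2 * Real.log (1 / δ) * ξ / (n : ℝ) ^ 2)

/-- The term `B_φ`, with block length `L`. -/
def termB (r Φ δ : ℝ) (n L : ℕ) : ℝ :=
  (3.15 * L + 2 * Φ) * r * Real.log (1 / δ) / n

end PhiMixing

end

noncomputable section

namespace PhiMixing

/-! Subtracting `μ_n`, dividing by the range and averaging over blocks of length `L` gives centred
variables `ξ_k` in an interval `[-q, p]` of length one, known at time `k + 1` of the block
filtration. They are dependent, but their correctors `g_j = E[∑_{j ≤ k < N} ξ_k | 𝓕_j]` are small:
φ-mixing moves the conditional mean of a variable of range `c` at lag `d` by at most `c φ(d)`, and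
summing over lags gives `|g_j| ≤ f = Φ_n / L`. The variables `ξ_k + g_{k+1} - g_k` are martingale
differences with the same total sum as the `ξ_k`, because `g_0 = g_N = 0`.

Bernstein's inequality for these differences involves the random conditional variances `E[ξ_k² |
𝓕_k]`. The centred squares have a corrector `H_j` too, and adding `ζ H_j` to the exponent, with `ζ`
the coefficient of the conditional variance, trades these variances for their expectations
(`chernoff_of_corrector_bounds`). Expanding a block square by its smaller index gives summands of
range at most `2 / L`, whence `|H_j| ≤ 2 f`.

The optimised bound `bernstein_of_corrector_bounds` is used three times: for both tails of `∑ ξ_k`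
in terms of `V = ∑ E ξ_k²`, and for the lower tail of `∑ ξ_k²`, which replaces `V` by the observed
sum of squares. Each use costs `e^{-u} = δ`.

Finally, centring the blocks at the empirical mean lowers the sum of squares of the block sums by
exactly `D² / m`, where `D` is the total centred sum. This costs `√(2u/m) |D|`, which is absorbed on
the left and produces the factor `ν̃_n(δ)` (`abs_avg_sub_le`). -/

/-! ### Conditional Bernstein inequalities and exponential supermartingales -/

theorem exp_le_one_add_add_sq {z c : ℝ} (hz : |z| ≤ c) (hc : c < 3) :
    Real.exp z ≤ 1 + z + z ^ 2 / (2 * (1 - c / 3)) := by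
  have hz3 : |z| / 3 < 1 := by linarith
  have hgeo := hasSum_geometric_of_lt_one (by positivity : 0 ≤ |z| / 3) hz3
  have hexp : HasSum (fun k : ℕ => z ^ k / (k.factorial : ℝ)) (Real.exp z) := by
    rw [Real.exp_eq_exp_ℝ]
    exact NormedSpace.expSeries_div_hasSum_exp z
  have htail := (hasSum_nat_add_iff' 2).2 hexp
  -- This dominates the exponential series from the second-order term on by a geometric series of
  -- ratio `|z| / 3`.
  have hfact : ∀ k : ℕ, (2 * 3 ^ k : ℝ) ≤ ((k + 2).factorial : ℝ) := by
    intro k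
    induction k with
    | zero => norm_num
    | succ k ih =>
      rw [Nat.factorial_succ (k + 2), pow_succ]
      push_cast
      have : (0 : ℝ) ≤ k := k.cast_nonneg
      nlinarith [pow_pos (by norm_num : (0 : ℝ) < 3) k]
  have hle := hasSum_le (fun k => ?_) htail (hgeo.mul_left (z ^ 2 / 2))
  · have h1 : z ^ 2 / 2 * (1 - |z| / 3)⁻¹ ≤ z ^ 2 / (2 * (1 - c / 3)) := by
      rw [← div_eq_mul_inv, div_div]
      gcongr
      linarith
    norm_num [Finset.sum_range_succ] at hle
    linarith
  · have h2 : z ^ (k + 2) ≤ z ^ 2 * |z| ^ k := by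
      calc z ^ (k + 2) ≤ |z ^ (k + 2)| := le_abs_self _
        _ = z ^ 2 * |z| ^ k := by rw [abs_pow, pow_add, sq_abs, mul_comm]
    calc z ^ (k + 2) / ((k + 2).factorial : ℝ) ≤ (z ^ 2 * |z| ^ k) / (2 * 3 ^ k) := by
          gcongr
          exact hfact k
      _ = z ^ 2 / 2 * (|z| / 3) ^ k := by rw [div_pow, div_mul_div_comm]

section

variable {Ω : Type*} {m m0 : MeasurableSpace Ω} {P : Measure Ω} [IsProbabilityMeasure P]

theorem condExp_mem_Icc {A : Ω → ℝ} {lo hi : ℝ} (hm : m ≤ m0) (hA : AEStronglyMeasurable A P)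
    (hAb : ∀ᵐ ω ∂P, A ω ∈ Set.Icc lo hi) : ∀ᵐ ω ∂P, (P[A | m]) ω ∈ Set.Icc lo hi := by
  have hi' : Integrable A P := Integrable.of_mem_Icc lo hi hA.aemeasurable hAb
  have h1 : P[(fun _ => lo) | m] ≤ᵐ[P] P[A | m] :=
    condExp_mono (integrable_const _) hi' (hAb.mono fun ω h => h.1)
  have h2 : P[A | m] ≤ᵐ[P] P[(fun _ => hi) | m] :=
    condExp_mono hi' (integrable_const _) (hAb.mono fun ω h => h.2)
  rw [condExp_const hm] at h1 h2
  filter_upwards [h1, h2] with ω a b using ⟨a, b⟩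

/-- Conditional Bernstein inequality for a centred bounded variable. -/
theorem condExp_exp_sub_le_one {z q : Ω → ℝ} {c C : ℝ} (hm : m ≤ m0)
    (hz : AEStronglyMeasurable z P) (hc3 : c < 3)
    (hzc : ∀ᵐ ω ∂P, |z ω| ≤ c) (h0 : P[z | m] =ᵐ[P] 0) (hq : StronglyMeasurable[m] q)
    (hqb : ∀ᵐ ω ∂P, |q ω| ≤ C) (hvar : P[fun ω => z ω ^ 2 | m] ≤ᵐ[P] q) :
    P[fun ω => Real.exp (z ω - q ω / (2 * (1 - c / 3))) | m] ≤ᵐ[P] fun _ => 1 := by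
  set κ : ℝ := (2 * (1 - c / 3))⁻¹ with hκ
  have hκ0 : 0 < κ := inv_pos.2 (by linarith)
  have hzi : Integrable z P := Integrable.of_bound hz c (hzc.mono fun ω h => by simpa using h)
  have hz2i : Integrable (fun ω => z ω ^ 2) P :=
    Integrable.of_bound (hz.pow 2) (c ^ 2) (hzc.mono fun ω h => by
      rw [Real.norm_eq_abs, abs_pow]; gcongr)
  have hei : Integrable (fun ω => Real.exp (z ω)) P :=
    Integrable.of_bound (Real.continuous_exp.comp_aestronglyMeasurable hz) (Real.exp c)
      (hzc.mono fun ω h => by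
        rw [Real.norm_eq_abs, Real.abs_exp]; exact Real.exp_le_exp.2 (abs_le.1 h).2)
  have hqm : StronglyMeasurable[m] (fun ω => Real.exp (-(κ * q ω))) :=
    Real.continuous_exp.comp_stronglyMeasurable (hq.const_mul κ).neg
  have hprod : Integrable ((fun ω => Real.exp (-(κ * q ω))) * fun ω => Real.exp (z ω)) P := by
    refine Integrable.bdd_mul (c := Real.exp (κ * C)) hei (hqm.mono hm).aestronglyMeasurable ?_
    filter_upwards [hqb] with ω h
    rw [Real.norm_eq_abs, Real.abs_exp]
    apply Real.exp_le_exp.2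
    nlinarith [(abs_le.1 h).1]
  have hfun : (fun ω => Real.exp (z ω - q ω / (2 * (1 - c / 3))))
      = (fun ω => Real.exp (-(κ * q ω))) * fun ω => Real.exp (z ω) := by
    funext ω
    rw [Pi.mul_apply, ← Real.exp_add, hκ]
    congr 1
    ring
  rw [hfun]
  have hpull := condExp_mul_of_stronglyMeasurable_left (μ := P) hqm hprod hei
  have hlin : P[fun ω => Real.exp (z ω) | m]
      ≤ᵐ[P] P[(fun _ => (1 : ℝ)) + z + κ • (fun ω => z ω ^ 2) | m] := by
    refine condExp_mono hei (((integrable_const _).add hzi).add (hz2i.smul κ)) ?_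
    filter_upwards [hzc] with ω h
    have := exp_le_one_add_add_sq h hc3
    simp only [Pi.add_apply, Pi.smul_apply, smul_eq_mul, hκ]
    rw [div_eq_inv_mul] at this
    exact this
  have hadd1 := condExp_add (μ := P) ((integrable_const (1 : ℝ)).add hzi) (hz2i.smul κ) m
  have hadd2 := condExp_add (μ := P) (integrable_const (1 : ℝ)) hzi m
  have hsm := condExp_smul (μ := P) κ (fun ω => z ω ^ 2) m
  rw [condExp_const hm] at hadd2
  filter_upwards [hpull, hlin, hadd1, hadd2, hsm, h0, hvar] with ω e1 e2 e3 e4 e5 e6 e7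
  rw [e1, Pi.mul_apply]
  rw [e3, Pi.add_apply, e4, e5, Pi.add_apply, Pi.smul_apply, e6, smul_eq_mul] at e2
  simp only [Pi.zero_apply] at e2
  have e8 : (P[fun ω => Real.exp (z ω) | m]) ω ≤ Real.exp (κ * q ω) := by
    have := Real.add_one_le_exp (κ * q ω)
    nlinarith [mul_le_mul_of_nonneg_left e7 hκ0.le]
  calc Real.exp (-(κ * q ω)) * (P[fun ω => Real.exp (z ω) | m]) ω
      ≤ Real.exp (-(κ * q ω)) * Real.exp (κ * q ω) := by gcongr
    _ = 1 := by rw [← Real.exp_add]; simp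

/-- Conditional Bernstein inequality for `A + G`, the variance being split by a Young inequality. -/
theorem condExp_exp_add_le_one {A G qA : Ω → ℝ} {lo M γ c₁ c₂ C : ℝ} (hm : m ≤ m0)
    (hA : AEStronglyMeasurable A P) (hG : AEStronglyMeasurable G P)
    (hAb : ∀ᵐ ω ∂P, A ω ∈ Set.Icc lo (lo + M)) (hGb : ∀ᵐ ω ∂P, |G ω| ≤ γ)
    (hc : M + 2 * γ < 3) (hc₁ : 0 ≤ c₁) (hc₂ : 0 ≤ c₂)
    (hyoung : ∀ x y : ℝ, |y| ≤ 2 * γ → (x + y) ^ 2 ≤ c₁ * x ^ 2 + c₂ * y ^ 2)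
    (hq : StronglyMeasurable[m] qA) (hqb : ∀ᵐ ω ∂P, |qA ω| ≤ C)
    (hvar : P[fun ω => A ω ^ 2 | m] ≤ᵐ[P] qA) :
    P[fun ω => Real.exp (A ω + G ω - ((P[A | m]) ω + (P[G | m]) ω)
      - (c₁ * qA ω + c₂ * γ ^ 2) / (2 * (1 - (M + 2 * γ) / 3))) | m] ≤ᵐ[P] fun _ => 1 := by
  have hγb : ∀ᵐ ω ∂P, G ω ∈ Set.Icc (-γ) γ := hGb.mono fun ω h => abs_le.1 h
  have hEA := condExp_mem_Icc hm hA hAb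
  have hEG := condExp_mem_Icc hm hG hγb
  have hAi : Integrable A P := Integrable.of_mem_Icc _ _ hA.aemeasurable hAb
  have hGi : Integrable G P := Integrable.of_mem_Icc _ _ hG.aemeasurable hγb
  have hA2 : MemLp A 2 P := MemLp.of_bound hA (|lo| + |lo + M|) (hAb.mono fun ω h => by
    rw [Real.norm_eq_abs]
    exact (abs_le_max_abs_abs h.1 h.2).trans (max_le_add_of_nonneg (abs_nonneg _) (abs_nonneg _)))
  have hG2 : MemLp G 2 P := MemLp.of_bound hG γ (hGb.mono fun ω h => by simpa using h)
  have hzA : AEStronglyMeasurable (A - P[A | m]) P := hA.sub integrable_condExp.1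
  have hzG : AEStronglyMeasurable (G - P[G | m]) P := hG.sub integrable_condExp.1
  -- A variable and its conditional mean lie in the same interval, so centring costs only the width:
  -- `M` for `A`, `2 * γ` for `G`.
  have hzAb : ∀ᵐ ω ∂P, |(A - P[A | m]) ω| ≤ M := by
    filter_upwards [hAb, hEA] with ω h1 h2
    rw [Pi.sub_apply, abs_le]
    exact ⟨by linarith [h1.1, h2.2], by linarith [h1.2, h2.1]⟩
  have hzGb : ∀ᵐ ω ∂P, |(G - P[G | m]) ω| ≤ 2 * γ := by
    filter_upwards [hγb, hEG] with ω h1 h2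
    rw [Pi.sub_apply, abs_le]
    exact ⟨by linarith [h1.1, h2.2], by linarith [h1.2, h2.1]⟩
  have hzA2i : Integrable (fun ω => (A - P[A | m]) ω ^ 2) P := (hA2.sub (hA2.condExp one_le_two)).integrable_sq
  have hzG2i : Integrable (fun ω => (G - P[G | m]) ω ^ 2) P := (hG2.sub (hG2.condExp one_le_two)).integrable_sq
  have hfun : (fun ω => Real.exp (A ω + G ω - ((P[A | m]) ω + (P[G | m]) ω)
      - (c₁ * qA ω + c₂ * γ ^ 2) / (2 * (1 - (M + 2 * γ) / 3)))) =
      fun ω => Real.exp (((A - P[A | m]) + (G - P[G | m])) ω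
        - (fun ω => c₁ * qA ω + c₂ * γ ^ 2) ω / (2 * (1 - (M + 2 * γ) / 3))) := by
    funext ω
    simp only [Pi.add_apply, Pi.sub_apply]
    congr 2
    ring
  rw [hfun]
  refine condExp_exp_sub_le_one (C := c₁ * C + c₂ * γ ^ 2) hm (hzA.add hzG) hc ?_ ?_ ?_ ?_ ?_
  · filter_upwards [hzAb, hzGb] with ω h1 h2
    exact (abs_add_le _ _).trans (add_le_add h1 h2)
  · have e1 := condExp_add (μ := P) (hAi.sub integrable_condExp) (hGi.sub integrable_condExp)
      (m := m) (f := A - P[A | m]) (g := G - P[G | m])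
    have e2 := condExp_sub (μ := P) hAi (integrable_condExp (f := A) (m := m)) m
    have e3 := condExp_sub (μ := P) hGi (integrable_condExp (f := G) (m := m)) m
    rw [condExp_of_stronglyMeasurable hm stronglyMeasurable_condExp integrable_condExp] at e2 e3
    filter_upwards [e1, e2, e3] with ω a1 a2 a3
    rw [a1, Pi.add_apply, a2, a3]
    simp
  · exact (hq.const_mul c₁).add stronglyMeasurable_const
  · filter_upwards [hqb] with ω h
    refine (abs_add_le _ _).trans ?_
    rw [abs_mul, abs_of_nonneg hc₁, abs_of_nonneg (by positivity : 0 ≤ c₂ * γ ^ 2)]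
    gcongr
  · have hmono : P[fun ω => ((A - P[A | m]) + (G - P[G | m])) ω ^ 2 | m] ≤ᵐ[P]
        P[(c₁ • fun ω => (A - P[A | m]) ω ^ 2) + (c₂ • fun ω => (G - P[G | m]) ω ^ 2) | m] := by
      refine condExp_mono ((hA2.sub (hA2.condExp one_le_two)).add (hG2.sub (hG2.condExp one_le_two))).integrable_sq
        ((hzA2i.smul c₁).add (hzG2i.smul c₂)) ?_
      filter_upwards [hzGb] with ω h
      exact hyoung _ _ h
    have e1 := condExp_add (μ := P) (hzA2i.smul c₁) (hzG2i.smul c₂) m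
    have e2 := condExp_smul (μ := P) c₁ (fun ω => (A - P[A | m]) ω ^ 2) m
    have e3 := condExp_smul (μ := P) c₂ (fun ω => (G - P[G | m]) ω ^ 2) m
    have v1 := condVar_ae_le_condExp_sq (μ := P) hm hA2
    have v2 := condVar_ae_le_condExp_sq (μ := P) hm hG2
    have v3 : ∀ᵐ ω ∂P, (P[G ^ 2 | m]) ω ∈ Set.Icc 0 (γ ^ 2) :=
      condExp_mem_Icc hm (hG.pow 2) (hGb.mono fun ω h => ⟨by simp only [Pi.pow_apply]; positivity,
        by rw [Pi.pow_apply, ← sq_abs]; gcongr⟩)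
    filter_upwards [hmono, e1, e2, e3, v1, v2, v3, hvar] with ω a1 a2 a3 a4 a5 a6 a7 a8
    refine a1.trans ?_
    rw [a2, Pi.add_apply, a3, a4, Pi.smul_apply, Pi.smul_apply, smul_eq_mul, smul_eq_mul]
    exact add_le_add (mul_le_mul_of_nonneg_left (a5.trans a8) hc₁)
      (mul_le_mul_of_nonneg_left (a6.trans a7.2) hc₂)

/-- The exponential of a sum of adapted variables whose exponentials have conditional mean at
most one has mean at most one. -/
theorem integral_exp_sum_le_one {𝓕 : Filtration ℕ m0} {x : ℕ → Ω → ℝ} {C : ℝ} {N : ℕ}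
    (hx : ∀ k < N, StronglyMeasurable[𝓕 (k + 1)] (x k))
    (hxb : ∀ k < N, ∀ᵐ ω ∂P, |x k ω| ≤ C)
    (hx1 : ∀ k < N, P[fun ω => Real.exp (x k ω) | 𝓕 k] ≤ᵐ[P] fun _ => 1) :
    Integrable (fun ω => Real.exp (∑ k ∈ Finset.range N, x k ω)) P ∧
      ∫ ω, Real.exp (∑ k ∈ Finset.range N, x k ω) ∂P ≤ 1 := by
  induction N with
  | zero => simp
  | succ N ih =>
    obtain ⟨hi, hle⟩ := ih (fun k hk => hx k (by omega)) (fun k hk => hxb k (by omega))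
      (fun k hk => hx1 k (by omega))
    have hxN : AEStronglyMeasurable (fun ω => Real.exp (x N ω)) P :=
      Real.continuous_exp.comp_aestronglyMeasurable
        ((hx N (by omega)).mono (𝓕.le _)).aestronglyMeasurable
    have hbd : ∀ᵐ ω ∂P, ‖Real.exp (x N ω)‖ ≤ Real.exp C := by
      filter_upwards [hxb N (by omega)] with ω h
      rw [Real.norm_eq_abs, Real.abs_exp]
      exact Real.exp_le_exp.2 (abs_le.1 h).2
    have hei : Integrable (fun ω => Real.exp (x N ω)) P := Integrable.of_bound hxN _ hbd
    have hfun : (fun ω => Real.exp (∑ k ∈ Finset.range (N + 1), x k ω)) =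
        (fun ω => Real.exp (∑ k ∈ Finset.range N, x k ω)) * fun ω => Real.exp (x N ω) := by
      funext ω
      rw [Finset.sum_range_succ, Real.exp_add, Pi.mul_apply]
    have hprod : Integrable
        ((fun ω => Real.exp (∑ k ∈ Finset.range N, x k ω)) * fun ω => Real.exp (x N ω)) P :=
      Integrable.mul_bdd hi hxN hbd
    have hmeas : StronglyMeasurable[𝓕 N] (fun ω => Real.exp (∑ k ∈ Finset.range N, x k ω)) :=
      Real.continuous_exp.comp_stronglyMeasurable (Finset.stronglyMeasurable_fun_sum _ fun k hk =>
        (hx k (by have := Finset.mem_range.1 hk; omega)).mono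
          (𝓕.mono (Finset.mem_range.1 hk)))
    rw [hfun]
    refine ⟨hprod, ?_⟩
    rw [← integral_condExp (𝓕.le N)]
    refine le_trans (integral_mono_ae integrable_condExp hi ?_) hle
    filter_upwards [condExp_mul_of_stronglyMeasurable_left hmeas hprod hei, hx1 N (by omega)]
      with ω a1 a2
    rw [a1, Pi.mul_apply]
    calc _ ≤ Real.exp (∑ k ∈ Finset.range N, x k ω) * 1 := by gcongr
      _ = _ := mul_one _

theorem measureReal_le_exp_neg {Ω : Type*} [MeasurableSpace Ω] {P : Measure Ω}
    [IsFiniteMeasure P] {X : Ω → ℝ} (hi : Integrable (fun ω => Real.exp (X ω)) P)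
    (h1 : ∫ ω, Real.exp (X ω) ∂P ≤ 1) (u : ℝ) : P.real {ω | u ≤ X ω} ≤ Real.exp (-u) := by
  have h := mul_meas_ge_le_integral_of_nonneg (μ := P)
    (Eventually.of_forall fun ω => (Real.exp_pos (X ω)).le) hi (Real.exp u)
  simp only [Real.exp_le_exp] at h
  rw [Real.exp_neg, ← one_div, le_div_iff₀ (Real.exp_pos u), mul_comm]
  exact h.trans h1

/-- The projections of the remaining sum satisfy the one-step recursion of a corrector. -/
theorem condExp_corrector_succ {𝓕 : Filtration ℕ m0} {η : ℕ → Ω → ℝ} {N k : ℕ}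
    (hη : ∀ k, Integrable (η k) P) (hk : k < N) :
    P[P[fun ω => ∑ i ∈ Finset.Ico (k + 1) N, η i ω | 𝓕 (k + 1)] | 𝓕 k] =ᵐ[P]
      P[fun ω => ∑ i ∈ Finset.Ico k N, η i ω | 𝓕 k] - P[η k | 𝓕 k] := by
  have h1 := condExp_condExp_of_le (μ := P) (f := fun ω => ∑ i ∈ Finset.Ico (k + 1) N, η i ω)
    (𝓕.mono (Nat.le_succ k)) (𝓕.le (k + 1))
  have h2 := condExp_add (μ := P) (hη k)
    (integrable_finsetSum (Finset.Ico (k + 1) N) fun i _ => hη i) (𝓕 k)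
  have hfun : (η k + fun ω => ∑ i ∈ Finset.Ico (k + 1) N, η i ω)
      = fun ω => ∑ i ∈ Finset.Ico k N, η i ω := by
    funext ω
    rw [Finset.sum_eq_sum_Ico_succ_bot hk, Pi.add_apply]
  rw [hfun] at h2
  filter_upwards [h1, h2] with ω a1 a2
  rw [a1, Pi.sub_apply, a2, Pi.add_apply]
  ring

end

/-! ### Chernoff bound by martingale correctors -/

section

variable {Ω : Type*} {m0 : MeasurableSpace Ω} {P : Measure Ω} [IsProbabilityMeasure P]

/-- Chernoff bound for `a ∑ ξ_k + b ∑ ξ_k²`, where `f` and `h` bound the conditional means of the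
remaining sums of `ξ_k` and of the centred squares. The fluctuation of the conditional variances
is compensated by adding `ζ` times the corrector of the squares. -/
theorem chernoff_of_corrector_bounds {𝓕 : Filtration ℕ m0} (h𝓕 : 𝓕 0 = ⊥) {ξ : ℕ → Ω → ℝ}
    {N : ℕ} {p q f h : ℝ} (hp : 0 ≤ p) (hq : 0 ≤ q) (hpq : p + q = 1)
    (hξm : ∀ k, StronglyMeasurable[𝓕 (k + 1)] (ξ k)) (hξ : ∀ k ω, ξ k ω ∈ Set.Icc (-q) p)
    (hξ0 : ∀ k, ∫ ω, ξ k ω ∂P = 0)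
    (hg : ∀ j ≤ N, ∀ᵐ ω ∂P, |(P[fun ω => ∑ k ∈ Finset.Ico j N, ξ k ω | 𝓕 j]) ω| ≤ f)
    (hH : ∀ j ≤ N, ∀ᵐ ω ∂P,
      |(P[fun ω => ∑ k ∈ Finset.Ico j N, (ξ k ω ^ 2 - ∫ ω', ξ k ω' ^ 2 ∂P) | 𝓕 j]) ω| ≤ h)
    {a b ν ζ lo M γ c₁ c₂ : ℝ}
    (hA : ∀ z ∈ Set.Icc (-q) p, a * z + b * z ^ 2 ∈ Set.Icc lo (lo + M))
    (hν : ∀ z ∈ Set.Icc (-q) p, (a * z + b * z ^ 2) ^ 2 ≤ ν * z ^ 2) (hν0 : 0 ≤ ν)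
    (hγ : |a| * f + |b + ζ| * h ≤ γ) (hc : M + 2 * γ < 3) (hc₁ : 0 ≤ c₁) (hc₂ : 0 ≤ c₂)
    (hyoung : ∀ x y : ℝ, |y| ≤ 2 * γ → (x + y) ^ 2 ≤ c₁ * x ^ 2 + c₂ * y ^ 2)
    (hζ : ζ = c₁ * ν / (2 * (1 - (M + 2 * γ) / 3))) (u : ℝ) :
    P.real {ω | u ≤ a * ∑ k ∈ Finset.range N, ξ k ω + b * ∑ k ∈ Finset.range N, ξ k ω ^ 2
      - (b + ζ) * ∑ k ∈ Finset.range N, ∫ ω', ξ k ω' ^ 2 ∂P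
      - N * (c₂ * γ ^ 2 / (2 * (1 - (M + 2 * γ) / 3)))} ≤ Real.exp (-u) := by
  have hz1 : ∀ k ω, |ξ k ω| ≤ 1 := fun k ω => by
    have := hξ k ω
    rw [abs_le]
    exact ⟨by linarith [this.1], by linarith [this.2]⟩
  have hW01 : ∀ k ω, ξ k ω ^ 2 ∈ Set.Icc (0 : ℝ) 1 := fun k ω =>
    ⟨sq_nonneg _, by rw [← sq_abs]; exact pow_le_one₀ (abs_nonneg _) (hz1 k ω)⟩
  have hξs : ∀ k, AEStronglyMeasurable (ξ k) P := fun k =>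
    ((hξm k).mono (𝓕.le _)).aestronglyMeasurable
  have hξi : ∀ k, Integrable (ξ k) P := fun k =>
    Integrable.of_mem_Icc _ _ (hξs k).aemeasurable (Eventually.of_forall (hξ k))
  have hWi : ∀ k, Integrable (fun ω => ξ k ω ^ 2) P := fun k =>
    Integrable.of_mem_Icc _ _ ((hξs k).pow 2).aemeasurable (Eventually.of_forall (hW01 k))
  set e : ℕ → ℝ := fun k => ∫ ω', ξ k ω' ^ 2 ∂P with he
  have hWci : ∀ k, Integrable (fun ω => ξ k ω ^ 2 - e k) P := fun k =>
    (hWi k).sub (integrable_const _)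
  set g : ℕ → Ω → ℝ := fun j => P[fun ω => ∑ k ∈ Finset.Ico j N, ξ k ω | 𝓕 j] with hgdef
  set H : ℕ → Ω → ℝ := fun j => P[fun ω => ∑ k ∈ Finset.Ico j N, (ξ k ω ^ 2 - e k) | 𝓕 j]
    with hHdef
  set w : ℕ → Ω → ℝ := fun k => P[fun ω => ξ k ω ^ 2 | 𝓕 k] with hwdef
  set A : ℕ → Ω → ℝ := fun k ω => a * ξ k ω + b * ξ k ω ^ 2 with hAdef
  set G : ℕ → Ω → ℝ := fun k ω => a * g k ω + (b + ζ) * H k ω with hGdef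
  set K : ℝ := 2 * (1 - (M + 2 * γ) / 3) with hK
  have hgm : ∀ j, StronglyMeasurable[𝓕 j] (g j) := fun j => stronglyMeasurable_condExp
  have hHm : ∀ j, StronglyMeasurable[𝓕 j] (H j) := fun j => stronglyMeasurable_condExp
  have hwm : ∀ j, StronglyMeasurable[𝓕 j] (w j) := fun j => stronglyMeasurable_condExp
  have hAm : ∀ k, StronglyMeasurable[𝓕 (k + 1)] (A k) := fun k =>
    ((hξm k).const_mul a).add (((hξm k).pow 2).const_mul b)
  have hGm : ∀ k, StronglyMeasurable[𝓕 k] (G k) := fun k =>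
    ((hgm k).const_mul a).add ((hHm k).const_mul (b + ζ))
  have hGb : ∀ j ≤ N, ∀ᵐ ω ∂P, |G j ω| ≤ γ := fun j hj => by
    filter_upwards [hg j hj, hH j hj] with ω h1 h2
    refine (abs_add_le _ _).trans (le_trans ?_ hγ)
    rw [abs_mul, abs_mul]
    gcongr
  have hwb : ∀ k, ∀ᵐ ω ∂P, w k ω ∈ Set.Icc (0 : ℝ) 1 := fun k =>
    condExp_mem_Icc (𝓕.le k) ((hξs k).pow 2) (Eventually.of_forall (hW01 k))
  have hvar : ∀ k, P[fun ω => A k ω ^ 2 | 𝓕 k] ≤ᵐ[P] fun ω => ν * w k ω := fun k => by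
    have hm1 : P[fun ω => A k ω ^ 2 | 𝓕 k] ≤ᵐ[P] P[ν • fun ω => ξ k ω ^ 2 | 𝓕 k] := by
      refine condExp_mono ?_ ((hWi k).smul ν) (Eventually.of_forall fun ω => hν _ (hξ k ω))
      refine Integrable.of_bound (C := ν)
        (((hAm k).mono (𝓕.le _)).aestronglyMeasurable.pow 2) (Eventually.of_forall fun ω => ?_)
      rw [Real.norm_of_nonneg (sq_nonneg _)]
      exact (hν _ (hξ k ω)).trans (mul_le_of_le_one_right hν0 (hW01 k ω).2)
    filter_upwards [hm1, condExp_smul (μ := P) ν (fun ω => ξ k ω ^ 2) (𝓕 k)] with ω a1 a2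
    rw [a2] at a1
    exact a1
  set x : ℕ → Ω → ℝ := fun k ω => A k ω + G (k + 1) ω
    - ((P[A k | 𝓕 k]) ω + (P[G (k + 1) | 𝓕 k]) ω) - (c₁ * (ν * w k ω) + c₂ * γ ^ 2) / K with hx
  have hxm : ∀ k < N, StronglyMeasurable[𝓕 (k + 1)] (x k) := fun k _ =>
    (((hAm k).add (hGm (k + 1))).sub ((stronglyMeasurable_condExp.mono (𝓕.mono k.le_succ)).add
      (stronglyMeasurable_condExp.mono (𝓕.mono k.le_succ)))).sub
      ((((((hwm k).mono (𝓕.mono k.le_succ)).const_mul ν).const_mul c₁).add_const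
        _).measurable.div_const K).stronglyMeasurable
  have hx1 : ∀ k < N, P[fun ω => Real.exp (x k ω) | 𝓕 k] ≤ᵐ[P] fun _ => 1 := fun k hk =>
    condExp_exp_add_le_one (C := ν) (𝓕.le k)
      ((hAm k).mono (𝓕.le _)).aestronglyMeasurable ((hGm (k + 1)).mono (𝓕.le _)).aestronglyMeasurable
      (Eventually.of_forall fun ω => hA _ (hξ k ω)) (hGb (k + 1) hk) hc hc₁ hc₂ hyoung
      ((hwm k).const_mul ν) ((hwb k).mono fun ω h => by
        rw [abs_of_nonneg (mul_nonneg hν0 h.1)]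
        exact mul_le_of_le_one_right hν0 h.2) (hvar k)
  have hK0 : 0 < K := by rw [hK]; linarith
  have hxb : ∀ k < N, ∀ᵐ ω ∂P, |x k ω| ≤ (M + 2 * γ) + (c₁ * ν + c₂ * γ ^ 2) / K := fun k hk => by
    have hAb : ∀ᵐ ω ∂P, A k ω ∈ Set.Icc lo (lo + M) := Eventually.of_forall fun ω => hA _ (hξ k ω)
    have hGb' : ∀ᵐ ω ∂P, G (k + 1) ω ∈ Set.Icc (-γ) γ :=
      (hGb (k + 1) hk).mono fun ω h => abs_le.1 h
    filter_upwards [hwb k, hAb, hGb', condExp_mem_Icc (𝓕.le k)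
      ((hAm k).mono (𝓕.le _)).aestronglyMeasurable hAb, condExp_mem_Icc (𝓕.le k)
      ((hGm (k + 1)).mono (𝓕.le _)).aestronglyMeasurable hGb'] with ω h1 h2 h3 h4 h5
    refine (abs_sub _ _).trans (add_le_add ?_ ?_)
    · rw [abs_le]
      exact ⟨by linarith [h2.1, h3.1, h4.2, h5.2], by linarith [h2.2, h3.2, h4.1, h5.1]⟩
    · rw [abs_of_nonneg (by have := h1.1; positivity)]
      have : ν * w k ω ≤ ν := mul_le_of_le_one_right hν0 h1.2
      gcongr
  obtain ⟨hi, hle⟩ := integral_exp_sum_le_one hxm hxb hx1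
  refine le_trans (le_of_eq ?_) (measureReal_le_exp_neg hi hle u)
  refine measureReal_congr ?_
  -- The conditional mean of `A k + G (k + 1)` is `G k + (b + ζ) * e k - ζ * w k`. Since `ζ = c₁ * ν
  -- / K`, its random part `ζ * w k` cancels the one in the variance term, and the rest telescopes.
  have hstep : ∀ k, ∀ᵐ ω ∂P, k < N → x k ω = a * ξ k ω + b * ξ k ω ^ 2 - (b + ζ) * e k
      - c₂ * γ ^ 2 / K + (G (k + 1) ω - G k ω) := fun k => by
    by_cases hk : k < N
    swap
    · exact Eventually.of_forall fun ω h => absurd h hk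
    have r1 := condExp_corrector_succ (𝓕 := 𝓕) hξi hk
    have r2 := condExp_corrector_succ (𝓕 := 𝓕) hWci hk
    have r3 := condExp_add (μ := P) ((hξi k).smul a) ((hWi k).smul b) (𝓕 k)
    have r4 := condExp_smul (μ := P) a (ξ k) (𝓕 k)
    have r5 := condExp_smul (μ := P) b (fun ω => ξ k ω ^ 2) (𝓕 k)
    have r6 := condExp_add (μ := P) ((integrable_condExp (f := fun ω =>
      ∑ i ∈ Finset.Ico (k + 1) N, ξ i ω) (m := 𝓕 (k + 1))).smul a)
      ((integrable_condExp (f := fun ω => ∑ i ∈ Finset.Ico (k + 1) N, (ξ i ω ^ 2 - e i))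
        (m := 𝓕 (k + 1))).smul (b + ζ)) (𝓕 k)
    have r7 := condExp_smul (μ := P) a (g (k + 1)) (𝓕 k)
    have r8 := condExp_smul (μ := P) (b + ζ) (H (k + 1)) (𝓕 k)
    have r9 := condExp_sub (μ := P) (hWi k) (integrable_const (e k)) (𝓕 k)
    rw [condExp_const (𝓕.le k)] at r9
    filter_upwards [r1, r2, r3, r4, r5, r6, r7, r8, r9] with ω a1 a2 a3 a4 a5 a6 a7 a8 a9 _
    have b1 : (P[A k | 𝓕 k]) ω = a * (P[ξ k | 𝓕 k]) ω + b * w k ω := by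
      refine a3.trans ?_
      rw [Pi.add_apply, a4, a5]
      rfl
    have b2 : (P[G (k + 1) | 𝓕 k]) ω
        = a * (P[g (k + 1) | 𝓕 k]) ω + (b + ζ) * (P[H (k + 1) | 𝓕 k]) ω := by
      refine a6.trans ?_
      rw [Pi.add_apply, a7, a8]
      rfl
    have b3 : (P[g (k + 1) | 𝓕 k]) ω = g k ω - (P[ξ k | 𝓕 k]) ω := a1
    have b4 : (P[H (k + 1) | 𝓕 k]) ω = H k ω - (w k ω - e k) := a2.trans (by
      rw [Pi.sub_apply]
      congr 1)
    have b5 : (c₁ * (ν * w k ω) + c₂ * γ ^ 2) / K = ζ * w k ω + c₂ * γ ^ 2 / K := by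
      rw [hζ]
      ring
    simp only [hx]
    rw [b1, b2, b3, b4, b5]
    simp only [hAdef, hGdef]
    ring
  -- No boundary terms remain: the sum defining the corrector is empty at `N`, and at `0`
  -- conditioning on the trivial σ-algebra gives the mean, which is zero.
  have hGN : G N = fun _ => 0 := by
    funext ω
    simp only [hGdef, hgdef, hHdef, Finset.Ico_self, Finset.sum_empty]
    rw [show (fun _ : Ω => (0 : ℝ)) = 0 from rfl, condExp_zero]
    simp
  have hG0 : G 0 = fun _ => 0 := by
    funext ω
    simp only [hGdef, hgdef, hHdef]
    rw [h𝓕, condExp_bot, condExp_bot, integral_finsetSum _ fun i _ => hξi i,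
      integral_finsetSum _ fun i _ => hWci i]
    simp only [hξ0, Finset.sum_const_zero, mul_zero, zero_add]
    rw [Finset.sum_eq_zero, mul_zero]
    intro i _
    rw [integral_sub (hWi i) (integrable_const _)]
    simp [he]
  filter_upwards [ae_all_iff.2 hstep] with ω hω
  have hsum : ∑ k ∈ Finset.range N, x k ω = a * ∑ k ∈ Finset.range N, ξ k ω
      + b * ∑ k ∈ Finset.range N, ξ k ω ^ 2 - (b + ζ) * ∑ k ∈ Finset.range N, e k
      - N * (c₂ * γ ^ 2 / K) := by
    rw [Finset.sum_congr rfl fun k hk => hω k (Finset.mem_range.1 hk), Finset.sum_add_distrib,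
      Finset.sum_range_sub (fun k => G k ω), hGN, hG0, Finset.sum_sub_distrib,
      Finset.sum_sub_distrib, Finset.sum_add_distrib, ← Finset.mul_sum, ← Finset.mul_sum,
      ← Finset.mul_sum, Finset.sum_const, Finset.card_range, nsmul_eq_mul]
    ring
  exact congrArg (fun t : ℝ => u ≤ t) hsum.symm

end

/-! ### Bernstein inequalities for the sum and for the sum of squares -/

/-- The two sides differ by `(D z - x y)² / (x D)`. The weights fit a main part of variance `x²` and
a corrector part of size `D²`, as `(1 + D/x) x² + (1 + x/D) D² = (x + D)²`. For `D = 0` the quotient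
`x / D` is `0`, so `y` has to vanish. -/
theorem sq_add_le_young {x D : ℝ} (hx : 0 < x) (hD : 0 ≤ D) {y z : ℝ} (hy : D = 0 → y = 0) :
    (z + y) ^ 2 ≤ (1 + D / x) * z ^ 2 + (1 + x / D) * y ^ 2 := by
  rcases hD.eq_or_lt with h | h
  · simp [hy h.symm, ← h]
  · have : (1 + D / x) * z ^ 2 + (1 + x / D) * y ^ 2 - (z + y) ^ 2 = (D * z - x * y) ^ 2 / (x * D) := by
      field_simp
      ring
    have h2 : 0 ≤ (D * z - x * y) ^ 2 / (x * D) := by positivity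
    linarith

section

variable {Ω : Type*} {m0 : MeasurableSpace Ω} {P : Measure Ω} [IsProbabilityMeasure P]

/-- Bernstein inequality for `a ∑ ξ_k + b ∑ (ξ_k² - E ξ_k²)` in terms of the sum of the second
moments of the `ξ_k`. -/
theorem bernstein_of_corrector_bounds {𝓕 : Filtration ℕ m0} (h𝓕 : 𝓕 0 = ⊥) {ξ : ℕ → Ω → ℝ}
    {N : ℕ} (hN : 0 < N) {p q f h : ℝ} (hp : 0 ≤ p) (hq : 0 ≤ q) (hpq : p + q = 1)
    (hξm : ∀ k, StronglyMeasurable[𝓕 (k + 1)] (ξ k)) (hξ : ∀ k ω, ξ k ω ∈ Set.Icc (-q) p)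
    (hξ0 : ∀ k, ∫ ω, ξ k ω ∂P = 0)
    (hg : ∀ j ≤ N, ∀ᵐ ω ∂P, |(P[fun ω => ∑ k ∈ Finset.Ico j N, ξ k ω | 𝓕 j]) ω| ≤ f)
    (hH : ∀ j ≤ N, ∀ᵐ ω ∂P,
      |(P[fun ω => ∑ k ∈ Finset.Ico j N, (ξ k ω ^ 2 - ∫ ω', ξ k ω' ^ 2 ∂P) | 𝓕 j]) ω| ≤ h)
    {a b lo x σ u : ℝ}
    (hA : ∀ z ∈ Set.Icc (-q) p, a * z + b * z ^ 2 ∈ Set.Icc lo (lo + 1))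
    (hν : ∀ z ∈ Set.Icc (-q) p, (a * z + b * z ^ 2) ^ 2 ≤ z ^ 2)
    (hu : 0 < u) (hx : 0 < x) (hV : ∑ k ∈ Finset.range N, ∫ ω', ξ k ω' ^ 2 ∂P ≤ x ^ 2)
    (hσ : |a| * f + |b + √(u / 2) / x| * h ≤ σ) (hσ0 : 0 ≤ σ) :
    P.real {ω | √(2 * u) * (x + √N * σ) + (1 + 2 * σ) * u / 3 ≤
      a * ∑ k ∈ Finset.range N, ξ k ω + b * (∑ k ∈ Finset.range N, ξ k ω ^ 2
        - ∑ k ∈ Finset.range N, ∫ ω', ξ k ω' ^ 2 ∂P)} ≤ Real.exp (-u) := by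
  have hN0 : (0 : ℝ) < √N := Real.sqrt_pos.2 (by exact_mod_cast hN)
  set D : ℝ := √N * σ with hD
  have hD0 : 0 ≤ D := by positivity
  have hD2 : D ^ 2 = N * σ ^ 2 := by rw [hD, mul_pow, Real.sq_sqrt (Nat.cast_nonneg _)]
  have hr : 0 < √(u / 2) := Real.sqrt_pos.2 (by positivity)
  set r : ℝ := √(u / 2) with hrdef
  have hr2 : r ^ 2 = u / 2 := Real.sq_sqrt (by positivity)
  have h2u : √(2 * u) = 2 * r := by
    rw [hrdef, show 2 * u = 2 ^ 2 * (u / 2) by ring, Real.sqrt_mul (by norm_num),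
      Real.sqrt_sq (by norm_num)]
  have hB : 0 < x + D := by positivity
  set s : ℝ := (1 + 2 * σ) / 3 with hs
  have hs0 : 0 < s := by positivity
  set t : ℝ := (x + D) / (2 * r) with ht
  have ht0 : 0 < t := by positivity
  -- The Chernoff parameter: it makes Bernstein's denominator equal to `2 * (l * t)` and turns the
  -- level `u` into `l * (r * (x + D) + s * u)`.
  set l : ℝ := 1 / (s + t) with hl
  have hl0 : 0 < l := by positivity
  have hlst : l * (s + t) = 1 := by rw [hl]; field_simp
  have hK : 2 * (1 - (l + 2 * (l * σ)) / 3) = 2 * (l * t) := by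
    have : l * (s + t) = (l + 2 * (l * σ)) / 3 + l * t := by rw [hs]; ring
    linarith
  -- The compensating coefficient is `l` times `r / x`, and `r / x` is free of `l`. Hence `σ`, on
  -- which `l` depends, can be fixed first.
  have hζ : l * (r / x) = (1 + D / x) * l ^ 2 / (2 * (1 - (l + 2 * (l * σ)) / 3)) := by
    rw [hK, ht]
    field_simp
  have hσD : D = 0 → σ = 0 := fun h0 => (mul_eq_zero.1 h0).resolve_left hN0.ne'
  have hmain := chernoff_of_corrector_bounds h𝓕 hp hq hpq hξm hξ hξ0 hg hH (a := l * a)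
    (b := l * b) (ν := l ^ 2) (ζ := l * (r / x)) (lo := l * lo) (M := l) (γ := l * σ)
    (c₁ := 1 + D / x) (c₂ := 1 + x / D) ?_ ?_ (sq_nonneg _) ?_ ?_ (by positivity) (by positivity)
    ?_ hζ u
  · refine le_trans (measureReal_mono ?_) hmain
    intro ω hω
    simp only [Set.mem_ofPred_eq] at hω ⊢
    set S := ∑ k ∈ Finset.range N, ξ k ω
    set v := ∑ k ∈ Finset.range N, ξ k ω ^ 2
    set V := ∑ k ∈ Finset.range N, ∫ ω', ξ k ω' ^ 2 ∂P
    have h1 : N * ((1 + x / D) * (l * σ) ^ 2 / (2 * (1 - (l + 2 * (l * σ)) / 3))) = l * (r * D) := by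
      have e : (N : ℝ) * ((1 + x / D) * (l * σ) ^ 2 / (2 * (1 - (l + 2 * (l * σ)) / 3)))
          = (1 + x / D) * l ^ 2 * D ^ 2 / (2 * (l * t)) := by
        rw [hK, hD2]
        ring
      rw [e]
      rcases hD0.eq_or_lt with h0 | h0
      · rw [← h0]; simp
      · rw [ht]; field_simp; ring
    have h2 : l * (r / x) * V ≤ l * (r * x) := by
      calc l * (r / x) * V ≤ l * (r / x) * x ^ 2 := by gcongr
        _ = l * (r * x) := by field_simp
    have h3 : u = l * (r * (x + D) + s * u) := by
      have : r * (x + D) = t * u := by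
        have hu2 : u = 2 * r ^ 2 := by linarith
        rw [hu2, ht]; field_simp
      rw [this]
      linear_combination (-u) * hlst
    have h4 : (1 + 2 * σ) * u / 3 = s * u := by rw [hs]; ring
    rw [h2u, h4] at hω
    have h5 := mul_le_mul_of_nonneg_left hω hl0.le
    rw [h1]
    linarith
  · intro z hz
    have := hA z hz
    have e : l * a * z + l * b * z ^ 2 = l * (a * z + b * z ^ 2) := by ring
    rw [e]
    exact ⟨by gcongr; exact this.1, by nlinarith [this.2]⟩
  · intro z hz
    have e : (l * a * z + l * b * z ^ 2) ^ 2 = l ^ 2 * (a * z + b * z ^ 2) ^ 2 := by ring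
    rw [e]
    exact mul_le_mul_of_nonneg_left (hν z hz) (sq_nonneg _)
  · rw [← mul_add, abs_mul, abs_mul, abs_of_pos hl0]
    calc l * |a| * f + l * |b + r / x| * h = l * (|a| * f + |b + r / x| * h) := by ring
      _ ≤ l * σ := by gcongr
  · have : 0 < l * t := by positivity
    linarith
  · intro z y hy
    refine sq_add_le_young hx hD0 fun h0 => ?_
    rw [hσD h0] at hy
    simpa using hy

/-- Bernstein inequality for the sum of the `ξ_k`; `ε = 1` and `ε = -1` give the two tails. -/
theorem bernstein_sum {𝓕 : Filtration ℕ m0} (h𝓕 : 𝓕 0 = ⊥) {ξ : ℕ → Ω → ℝ}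
    {N : ℕ} (hN : 0 < N) {p q f h : ℝ} (hp : 0 ≤ p) (hq : 0 ≤ q) (hpq : p + q = 1)
    (hξm : ∀ k, StronglyMeasurable[𝓕 (k + 1)] (ξ k)) (hξ : ∀ k ω, ξ k ω ∈ Set.Icc (-q) p)
    (hξ0 : ∀ k, ∫ ω, ξ k ω ∂P = 0) (hf : 0 ≤ f) (hh : 0 ≤ h)
    (hg : ∀ j ≤ N, ∀ᵐ ω ∂P, |(P[fun ω => ∑ k ∈ Finset.Ico j N, ξ k ω | 𝓕 j]) ω| ≤ f)
    (hH : ∀ j ≤ N, ∀ᵐ ω ∂P,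
      |(P[fun ω => ∑ k ∈ Finset.Ico j N, (ξ k ω ^ 2 - ∫ ω', ξ k ω' ^ 2 ∂P) | 𝓕 j]) ω| ≤ h)
    {ε x u : ℝ} (hε : ε = 1 ∨ ε = -1) (hu : 0 < u) (hx : 0 < x)
    (hV : ∑ k ∈ Finset.range N, ∫ ω', ξ k ω' ^ 2 ∂P ≤ x ^ 2) :
    P.real {ω | √(2 * u) * (x + √N * (f + √(u / 2) / x * h))
      + (1 + 2 * (f + √(u / 2) / x * h)) * u / 3 ≤ ε * ∑ k ∈ Finset.range N, ξ k ω}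
      ≤ Real.exp (-u) := by
  have hε1 : |ε| = 1 := by rcases hε with rfl | rfl <;> simp
  have hmain := bernstein_of_corrector_bounds h𝓕 hN hp hq hpq hξm hξ hξ0 hg hH (a := ε) (b := 0)
    (lo := if ε = 1 then -q else -p) (x := x) (σ := f + √(u / 2) / x * h) (u := u) ?_ ?_ hu hx hV
    ?_ (by positivity)
  · simpa only [zero_mul, add_zero] using hmain
  · rintro z ⟨h1, h2⟩
    rcases hε with rfl | rfl
    · rw [if_pos rfl]
      exact ⟨by linarith, by linarith⟩
    · rw [if_neg (by norm_num)]
      exact ⟨by linarith, by linarith⟩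
  · intro z _
    rcases hε with rfl | rfl <;> simp
  · rw [hε1, zero_add, abs_of_nonneg (by positivity), one_mul]

/-- Lower tail of the sum of the squares. -/
theorem bernstein_sum_sq {𝓕 : Filtration ℕ m0} (h𝓕 : 𝓕 0 = ⊥) {ξ : ℕ → Ω → ℝ}
    {N : ℕ} (hN : 0 < N) {p q f h : ℝ} (hp : 0 ≤ p) (hq : 0 ≤ q) (hpq : p + q = 1)
    (hξm : ∀ k, StronglyMeasurable[𝓕 (k + 1)] (ξ k)) (hξ : ∀ k ω, ξ k ω ∈ Set.Icc (-q) p)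
    (hξ0 : ∀ k, ∫ ω, ξ k ω ∂P = 0) (hh : 0 ≤ h)
    (hg : ∀ j ≤ N, ∀ᵐ ω ∂P, |(P[fun ω => ∑ k ∈ Finset.Ico j N, ξ k ω | 𝓕 j]) ω| ≤ f)
    (hH : ∀ j ≤ N, ∀ᵐ ω ∂P,
      |(P[fun ω => ∑ k ∈ Finset.Ico j N, (ξ k ω ^ 2 - ∫ ω', ξ k ω' ^ 2 ∂P) | 𝓕 j]) ω| ≤ h)
    {V u : ℝ} (hu : 0 < u) (hV : V = ∑ k ∈ Finset.range N, ∫ ω', ξ k ω' ^ 2 ∂P) :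
    P.real {ω | √(2 * u) * (√V + √N * h) + (1 + 2 * h) * u / 3 ≤
      V - ∑ k ∈ Finset.range N, ξ k ω ^ 2} ≤ Real.exp (-u) := by
  have hV0 : 0 ≤ V := by
    rw [hV]
    exact Finset.sum_nonneg fun k _ => integral_nonneg fun ω => sq_nonneg _
  -- Below `u / 8` the threshold, at least `u / 3`, exceeds `V`, and the event is empty. Above, `√(u
  -- / 2) / √V ≤ 2`, so the coefficient `-1 + √(u / 2) / √V` of the corrector of the squares is at
  -- most one in absolute value.
  by_cases hVu : V < u / 8
  · have hempty : {ω | √(2 * u) * (√V + √N * h) + (1 + 2 * h) * u / 3 ≤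
        V - ∑ k ∈ Finset.range N, ξ k ω ^ 2} = ∅ := by
      refine Set.eq_empty_of_forall_notMem fun ω hω => ?_
      simp only [Set.mem_ofPred_eq] at hω
      have h1 : 0 ≤ ∑ k ∈ Finset.range N, ξ k ω ^ 2 := Finset.sum_nonneg fun k _ => sq_nonneg _
      have h2 : 0 ≤ √(2 * u) * (√V + √N * h) := by positivity
      have h3 : 0 ≤ h * u := by positivity
      linarith
    rw [hempty]
    simpa using (Real.exp_pos (-u)).le
  · push Not at hVu
    have hVp : 0 < V := by linarith
    have hx : 0 < √V := Real.sqrt_pos.2 hVp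
    have hτ : √(u / 2) / √V ≤ 2 := by
      rw [div_le_iff₀ hx, show (2 : ℝ) = √4 by
        rw [show (4 : ℝ) = 2 ^ 2 by norm_num, Real.sqrt_sq (by norm_num)],
        ← Real.sqrt_mul (by norm_num)]
      exact Real.sqrt_le_sqrt (by linarith)
    have hτ0 : 0 ≤ √(u / 2) / √V := by positivity
    have hmain := bernstein_of_corrector_bounds h𝓕 hN hp hq hpq hξm hξ hξ0 hg hH (a := 0)
      (b := -1) (lo := -1) (x := √V) (σ := h) (u := u) ?_ ?_ hu hx
      (by rw [Real.sq_sqrt hV0, hV]) ?_ hh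
    · refine le_trans (measureReal_mono ?_) hmain
      intro ω hω
      simp only [Set.mem_ofPred_eq] at hω ⊢
      rw [← hV]
      linarith
    · rintro z ⟨h1, h2⟩
      exact ⟨by nlinarith, by nlinarith⟩
    · rintro z ⟨h1, h2⟩
      have h3 : z ^ 2 ≤ 1 := by nlinarith
      nlinarith [sq_nonneg z]
    · rw [abs_zero, zero_mul, zero_add]
      refine mul_le_of_le_one_left hh ?_
      rw [abs_le]
      constructor <;> linarith

end

/-! ### Replacing the variance by the sum of squares: the numerical constants -/

/-- This is the inequality behind `deviation_le` divided by `u`: `X`, `w`, `s` stand for `x`, `√v`,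
`f √N` over `√u`, and `k` for `√2`. The second case is a quadratic inequality in `X`, which forces
`X` to stay close to `w`. -/
theorem normalized_deviation_le {k X s f w : ℝ} (hk0 : 0 < k) (hk : k ^ 2 = 2) (hs : 0 ≤ s)
    (hf : 0 ≤ f) (hfs : k * f ≤ s) (hw : 0 ≤ w) (hX : 1 ≤ X)
    (hcase : X = 1 ∨ X ^ 2 - w ^ 2 ≤ k * (X + 2 * s) + (1 + 4 * f) / 3) :
    k * X + k * s + 2 * s / X + (1 + 2 * f + 2 * k * f / X) / 3
      ≤ k * w + 4 * k * s + 3.15 + 2 * f := by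
  have hk1 : 1.414 < k := by nlinarith
  have hk2 : k < 1.415 := by nlinarith
  have hks : 1.414 * s ≤ k * s := by gcongr
  have hkf : k * f ≤ 1.415 * f := by gcongr
  have hkw : 0 ≤ k * w := by positivity
  have h1 : 2 * s / X ≤ 2 * s := div_le_self (by positivity) hX
  have h2 : 2 * k * f / X ≤ 2 * k * f := div_le_self (by positivity) hX
  rcases hcase with h | h
  · subst h
    linarith
  -- The constants are what the other terms leave over: `2.81 < 3.15 - 1/3` and `0.38 < 2 - (2 + 2 *
  -- 1.415) / 3`.
  · suffices hsuff : k * X ≤ k * w + (3 * k - 2) * s + 2.81 + 0.38 * f by linarith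
    -- If `X > w + d`, then `X * (X - k) - w ^ 2` is at least `d * (d - k)`, which is more than `2 *
    -- k * s + (1 + 4 * f) / 3`.
    by_contra hcon
    push Not at hcon
    have hd : w + (1.99 + 1.58 * s + 0.26 * f) < X := by
      refine lt_of_mul_lt_mul_left (a := k) ?_ hk0.le
      nlinarith
    set d := 1.99 + 1.58 * s + 0.26 * f with hd'
    have e1 : 1.99 ≤ d := by rw [hd']; linarith [mul_nonneg (by norm_num : (0 : ℝ) ≤ 1.58) hs]
    have e2 : (w + d) * (w + d - k) ≤ X * (X - k) := by
      apply mul_le_mul hd.le (by linarith) (by linarith) (by linarith)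
    have e3 : d * (d - k) ≤ (w + d) * (w + d - k) - w ^ 2 := by nlinarith
    have e4 : d * (d - 1.415) ≤ d * (d - k) := by
      apply mul_le_mul_of_nonneg_left (by linarith) (by linarith)
    have e5 : 1.14 + 4 * s + 0.64 * f ≤ d * (d - 1.415) := by
      rw [hd']
      nlinarith [mul_nonneg hs hf, sq_nonneg s, sq_nonneg f]
    have e6 : 2 * (k * s) ≤ 2.83 * s := by nlinarith
    have e7 : 1.414 * f ≤ s := by nlinarith
    nlinarith

/-- Either `√V ≤ √u`, and the deviation is of order `u` without any estimate of `V`, or `x = √V` and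
`hV` is a quadratic inequality bounding `√V` by `√v`. The cutoff `√u` in `x` keeps the quotient `√(u
/ 2) / x` bounded. -/
theorem deviation_le {u N f v V x S : ℝ} (hu : 0 < u) (hN : 2 * u < N) (hf : 0 ≤ f) (hv : 0 ≤ v)
    (hV0 : 0 ≤ V) (hx : x = max (√V) (√u))
    (hS : S ≤ √(2 * u) * (x + √N * (f + √(u / 2) / x * (2 * f)))
      + (1 + 2 * (f + √(u / 2) / x * (2 * f))) * u / 3)
    (hV : V - v ≤ √(2 * u) * (√V + √N * (2 * f)) + (1 + 2 * (2 * f)) * u / 3) :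
    S ≤ √(2 * u) * √v + 4 * √(2 * u) * f * √N + (3.15 + 2 * f) * u := by
  set k := √(2 : ℝ) with hk
  have hk0 : 0 < k := by positivity
  have hk2 : k ^ 2 = 2 := Real.sq_sqrt (by norm_num)
  set c := √u with hc
  have hc0 : 0 < c := Real.sqrt_pos.2 hu
  have hcu : c ^ 2 = u := Real.sq_sqrt hu.le
  have h2u : √(2 * u) = k * c := Real.sqrt_mul (by norm_num) u
  have hu2 : √(u / 2) = c / k := Real.sqrt_div hu.le 2
  have hNk : k * c ≤ √N := by rw [← h2u]; exact Real.sqrt_le_sqrt hN.le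
  obtain ⟨X, hX⟩ : ∃ X, x = c * X := ⟨x / c, by field_simp⟩
  obtain ⟨w, hw⟩ : ∃ w, √v = c * w := ⟨√v / c, by field_simp⟩
  obtain ⟨s, hs⟩ : ∃ s, f * √N = c * s := ⟨f * √N / c, by field_simp⟩
  have hX1 : 1 ≤ X := by
    have : c * 1 ≤ c * X := by rw [← hX, hx, mul_one]; exact le_max_right _ _
    exact le_of_mul_le_mul_left this hc0
  have hX0 : 0 < X := by linarith
  have hw0 : 0 ≤ w := by
    have : c * 0 ≤ c * w := by rw [← hw, mul_zero]; positivity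
    exact le_of_mul_le_mul_left this hc0
  -- Here `2 * u < N` enters, as `√(2 * u) ≤ √N`.
  have hfs : k * f ≤ s := by
    have : c * (k * f) ≤ c * s := by rw [← hs]; nlinarith
    exact le_of_mul_le_mul_left this hc0
  have hs0 : 0 ≤ s := le_trans (by positivity) hfs
  have hvw : v = c ^ 2 * w ^ 2 := by rw [← mul_pow, ← hw, Real.sq_sqrt hv]
  have hcase : X = 1 ∨ X ^ 2 - w ^ 2 ≤ k * (X + 2 * s) + (1 + 4 * f) / 3 := by
    rcases le_total (√V) c with hle | hle
    · left
      rw [max_eq_right hle, hX] at hx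
      exact mul_left_cancel₀ hc0.ne' (hx.trans (mul_one c).symm)
    · right
      rw [max_eq_left hle] at hx
      have hVX : V = c ^ 2 * X ^ 2 := by rw [← mul_pow, ← hX, hx, Real.sq_sqrt hV0]
      rw [← hx, h2u, hX, hvw, ← hcu, hVX] at hV
      have e : c ^ 2 * (X ^ 2 - w ^ 2) ≤ c ^ 2 * (k * (X + 2 * s) + (1 + 4 * f) / 3) := by
        have e1 : k * c * (c * X + √N * (2 * f)) = c ^ 2 * (k * (X + 2 * s)) := by
          linear_combination 2 * k * c * hs
        linarith
      exact le_of_mul_le_mul_left e (by positivity)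
  have hfin := normalized_deviation_le hk0 hk2 hs0 hf hfs hw0 hX1 hcase
  have hl : √(2 * u) * (x + √N * (f + √(u / 2) / x * (2 * f)))
      + (1 + 2 * (f + √(u / 2) / x * (2 * f))) * u / 3 =
      c ^ 2 * (k * X + k * s + 2 * s / X + (1 + 2 * f + 2 * k * f / X) / 3) := by
    have e0 : √(u / 2) / x = k / (2 * X) := by
      rw [hu2, hX, div_div, div_eq_div_iff (by positivity) (by positivity)]
      linear_combination (-c * X) * hk2
    rw [e0, h2u, hX, ← hcu]
    have e1 : √N * (f + k / (2 * X) * (2 * f)) = c * s * (1 + k / X) := by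
      rw [← hs]; field_simp
    rw [e1]
    have e2 : 2 * s / X = k ^ 2 * s / X := by rw [hk2]
    rw [e2]
    field_simp
    ring
  have hr : √(2 * u) * √v + 4 * √(2 * u) * f * √N + (3.15 + 2 * f) * u =
      c ^ 2 * (k * w + 4 * k * s + 3.15 + 2 * f) := by
    rw [h2u, hw, ← hcu]
    linear_combination 4 * k * c * hs
  rw [hr]
  rw [hl] at hS
  exact hS.trans (mul_le_mul_of_nonneg_left hfin (sq_nonneg c))

/-! ### Empirical Bernstein inequality under corrector bounds -/

section

variable {Ω : Type*} {m0 : MeasurableSpace Ω} {P : Measure Ω} [IsProbabilityMeasure P]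

/-- Empirical Bernstein inequality, the variance being estimated by the sum of squares. -/
theorem empirical_bernstein_of_corrector_bounds {𝓕 : Filtration ℕ m0} (h𝓕 : 𝓕 0 = ⊥)
    {ξ : ℕ → Ω → ℝ} {N : ℕ} {p q f : ℝ} (hp : 0 ≤ p) (hq : 0 ≤ q) (hpq : p + q = 1)
    (hξm : ∀ k, StronglyMeasurable[𝓕 (k + 1)] (ξ k)) (hξ : ∀ k ω, ξ k ω ∈ Set.Icc (-q) p)
    (hξ0 : ∀ k, ∫ ω, ξ k ω ∂P = 0) (hf : 0 ≤ f)
    (hg : ∀ j ≤ N, ∀ᵐ ω ∂P, |(P[fun ω => ∑ k ∈ Finset.Ico j N, ξ k ω | 𝓕 j]) ω| ≤ f)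
    (hH : ∀ j ≤ N, ∀ᵐ ω ∂P,
      |(P[fun ω => ∑ k ∈ Finset.Ico j N, (ξ k ω ^ 2 - ∫ ω', ξ k ω' ^ 2 ∂P) | 𝓕 j]) ω| ≤ 2 * f)
    {u : ℝ} (hu : 0 < u) (huN : 2 * u < N) :
    1 - 3 * Real.exp (-u) ≤ P.real {ω | |∑ k ∈ Finset.range N, ξ k ω| ≤
      √(2 * u) * √(∑ k ∈ Finset.range N, ξ k ω ^ 2) + 4 * √(2 * u) * f * √N
        + (3.15 + 2 * f) * u} := by
  have hN : 0 < N := by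
    have : (0 : ℝ) < N := by linarith
    exact_mod_cast this
  obtain ⟨V, hV⟩ : ∃ V, V = ∑ k ∈ Finset.range N, ∫ ω', ξ k ω' ^ 2 ∂P := ⟨_, rfl⟩
  have hV0 : 0 ≤ V := by
    rw [hV]
    exact Finset.sum_nonneg fun k _ => integral_nonneg fun ω => sq_nonneg _
  obtain ⟨x, hx⟩ : ∃ x, x = max (√V) (√u) := ⟨_, rfl⟩
  have hx0 : 0 < x := by rw [hx]; exact lt_max_of_lt_right (Real.sqrt_pos.2 hu)
  have hVx : ∑ k ∈ Finset.range N, ∫ ω', ξ k ω' ^ 2 ∂P ≤ x ^ 2 := by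
    rw [← hV, hx]
    calc V = √V ^ 2 := (Real.sq_sqrt hV0).symm
      _ ≤ _ := by gcongr; exact le_max_left _ _
  have t1 := bernstein_sum h𝓕 hN hp hq hpq hξm hξ hξ0 hf (by positivity) hg hH (Or.inl rfl) hu hx0
    hVx
  have t2 := bernstein_sum h𝓕 hN hp hq hpq hξm hξ hξ0 hf (by positivity) hg hH (Or.inr rfl) hu hx0
    hVx
  have t3 := bernstein_sum_sq h𝓕 hN hp hq hpq hξm hξ hξ0 (by positivity) hg hH hu hV
  set E1 := {ω | √(2 * u) * (x + √N * (f + √(u / 2) / x * (2 * f)))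
      + (1 + 2 * (f + √(u / 2) / x * (2 * f))) * u / 3 ≤ 1 * ∑ k ∈ Finset.range N, ξ k ω}
  set E2 := {ω | √(2 * u) * (x + √N * (f + √(u / 2) / x * (2 * f)))
      + (1 + 2 * (f + √(u / 2) / x * (2 * f))) * u / 3 ≤ -1 * ∑ k ∈ Finset.range N, ξ k ω}
  set E3 := {ω | √(2 * u) * (√V + √N * (2 * f)) + (1 + 2 * (2 * f)) * u / 3 ≤
      V - ∑ k ∈ Finset.range N, ξ k ω ^ 2}
  set Good := {ω | |∑ k ∈ Finset.range N, ξ k ω| ≤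
      √(2 * u) * √(∑ k ∈ Finset.range N, ξ k ω ^ 2) + 4 * √(2 * u) * f * √N
        + (3.15 + 2 * f) * u}
  -- Outside the three exceptional events both tails follow from `deviation_le`; the union bound
  -- gives the factor `3`.
  have hcover : (Set.univ : Set Ω) ⊆ Good ∪ (E1 ∪ (E2 ∪ E3)) := by
    intro ω _
    by_contra hω
    simp only [Set.mem_union, not_or] at hω
    obtain ⟨g0, g1, g2, g3⟩ := hω
    simp only [Good, Set.mem_ofPred_eq] at g0
    simp only [E1, Set.mem_ofPred_eq, not_le] at g1
    simp only [E2, Set.mem_ofPred_eq, not_le] at g2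
    simp only [E3, Set.mem_ofPred_eq, not_le] at g3
    have hv : 0 ≤ ∑ k ∈ Finset.range N, ξ k ω ^ 2 := Finset.sum_nonneg fun k _ => sq_nonneg _
    refine g0 (abs_le'.2 ⟨?_, ?_⟩)
    · exact deviation_le hu huN hf hv hV0 hx (by linarith) g3.le
    · exact deviation_le hu huN hf hv hV0 hx (by linarith) g3.le
  have h1 : (1 : ℝ) ≤ P.real Good + (P.real E1 + (P.real E2 + P.real E3)) := by
    calc (1 : ℝ) = P.real Set.univ := probReal_univ.symm
      _ ≤ P.real (Good ∪ (E1 ∪ (E2 ∪ E3))) := measureReal_mono hcover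
      _ ≤ _ := (measureReal_union_le _ _).trans (by
        gcongr
        exact (measureReal_union_le _ _).trans (by gcongr; exact measureReal_union_le _ _))
  linarith

end

/-! ### φ-mixing and conditional expectations -/

section

variable {Ω S : Type*} {𝓖 : MeasurableSpace Ω} [m0 : MeasurableSpace Ω] [MeasurableSpace S]
  {P : Measure Ω}
  {Z : ℤ → Ω → S}

theorem sigmaGen_le (hZ : ∀ i, Measurable (Z i)) (s : Set ℤ) : sigmaGen Z s ≤ m0 :=
  iSup₂_le fun i _ => (hZ i).comap_le

omit m0 in
theorem sigmaGen_mono {s t : Set ℤ} (hst : s ⊆ t) : sigmaGen Z s ≤ sigmaGen Z t :=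
  biSup_mono hst

omit m0 in
theorem stronglyMeasurable_comp_sigmaGen {y : S → ℝ} (hy : Measurable y) {s : Set ℤ} {i : ℤ}
    (hi : i ∈ s) : StronglyMeasurable[sigmaGen Z s] fun ω => y (Z i ω) := by
  have h1 : MeasurableSpace.comap (Z i) inferInstance ≤ sigmaGen Z s :=
    le_iSup₂ (f := fun i (_ : i ∈ s) => MeasurableSpace.comap (Z i) inferInstance) i hi
  have h2 : Measurable[sigmaGen Z s] (Z i) := measurable_iff_comap_le.2 h1
  exact (hy.comp h2).stronglyMeasurable

theorem coeff_nonneg (k : ℕ) : 0 ≤ coeff P Z k := by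
  refine Real.sSup_nonneg ?_
  rintro r ⟨t, A, B, -, -, -, rfl⟩
  exact abs_nonneg _

theorem coeffSum_nonneg (n : ℕ) : 0 ≤ coeffSum P Z n :=
  Finset.sum_nonneg fun k _ => coeff_nonneg k

variable [IsProbabilityMeasure P]

theorem abs_inter_sub_mul_le_coeff (hZ : ∀ i, Measurable (Z i)) {t : ℤ} {k : ℕ} {A B : Set Ω}
    (hA : MeasurableSet[sigmaGen Z (Set.Iic t)] A)
    (hB : MeasurableSet[sigmaGen Z (Set.Ici (t + k))] B) :
    |P.real (A ∩ B) - P.real A * P.real B| ≤ coeff P Z k * P.real A := by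
  rcases eq_or_ne (P A) 0 with h0 | h0
  · have hA0 : P.real A = 0 := by rw [measureReal_def, h0]; rfl
    have hAB : P.real (A ∩ B) = 0 :=
      le_antisymm (hA0 ▸ measureReal_mono Set.inter_subset_left) measureReal_nonneg
    simp [hA0, hAB]
  · replace h0 : 0 < P A := pos_iff_ne_zero.2 h0
    have hbdd : BddAbove {r : ℝ | ∃ (t : ℤ) (A B : Set Ω),
        MeasurableSet[sigmaGen Z (Set.Iic t)] A ∧ 0 < P A ∧
        MeasurableSet[sigmaGen Z (Set.Ici (t + k))] B ∧
        r = |(cond P A).real B - P.real B|} := by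
      refine ⟨1, ?_⟩
      rintro r ⟨t, A, B, -, hpos, -, rfl⟩
      have := cond_isProbabilityMeasure hpos.ne'
      have h1 := measureReal_nonneg (μ := cond P A) (s := B)
      have h2 := measureReal_nonneg (μ := P) (s := B)
      have h3 := measureReal_le_one (μ := cond P A) (s := B)
      have h4 := measureReal_le_one (μ := P) (s := B)
      rw [abs_le]
      constructor <;> linarith
    have hle : |(cond P A).real B - P.real B| ≤ coeff P Z k :=
      le_csSup hbdd ⟨t, A, B, hA, h0, hB, rfl⟩
    have hApos : 0 < P.real A := ENNReal.toReal_pos h0.ne' (measure_ne_top _ _)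
    have hc : (cond P A).real B = (P.real A)⁻¹ * P.real (A ∩ B) := by
      rw [measureReal_def, cond_apply (sigmaGen_le hZ _ _ hA), ENNReal.toReal_mul,
        ENNReal.toReal_inv]
      rfl
    have e : P.real (A ∩ B) - P.real A * P.real B
        = ((cond P A).real B - P.real B) * P.real A := by
      rw [hc]; field_simp
    rw [e, abs_mul, abs_of_pos hApos]
    gcongr

omit [MeasurableSpace S] in
/-- If an event `A` is nearly independent of all events of a σ-algebra, then it is nearly
independent of all bounded variables measurable with respect to it. -/
theorem setIntegral_sub_le_of_forall_inter (hfle : 𝓖 ≤ m0) {A : Set Ω} (hA0 : MeasurableSet A)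
    {φ : ℝ} (hA : ∀ B, MeasurableSet[𝓖] B → P.real (A ∩ B) - P.real A * P.real B ≤ φ)
    {G : Ω → ℝ} (hG : StronglyMeasurable[𝓖] G) {lo c : ℝ}
    (hGb : ∀ ω, G ω ∈ Set.Icc lo (lo + c)) :
    ∫ ω in A, G ω ∂P - P.real A * ∫ ω, G ω ∂P ≤ c * φ := by
  obtain ⟨ω₀⟩ : Nonempty Ω := nonempty_of_isProbabilityMeasure P
  have hc : 0 ≤ c := by linarith [(hGb ω₀).1, (hGb ω₀).2]
  have hGs : AEStronglyMeasurable G P := (hG.mono hfle).aestronglyMeasurable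
  have hGi : Integrable G P :=
    Integrable.of_mem_Icc _ _ hGs.aemeasurable (Eventually.of_forall hGb)
  have h1i : Integrable (A.indicator fun _ => (1 : ℝ)) P := (integrable_const _).indicator hA0
  set π : Ω → ℝ := P[A.indicator fun _ => (1 : ℝ) | 𝓖] with hπ
  have hπi : Integrable π P := integrable_condExp
  have hGbd : ∀ᵐ ω ∂P, ‖G ω‖ ≤ |lo| + |lo + c| := Eventually.of_forall fun ω =>
    (abs_le_max_abs_abs (hGb ω).1 (hGb ω).2).trans
      (max_le_add_of_nonneg (abs_nonneg _) (abs_nonneg _))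
  have hGπi : Integrable (G * π) P := Integrable.bdd_mul hπi hGs hGbd
  have hG1i : Integrable (G * A.indicator fun _ => (1 : ℝ)) P := Integrable.bdd_mul h1i hGs hGbd
  have hint1 : ∫ ω, π ω ∂P = P.real A := by
    rw [hπ, integral_condExp hfle, integral_indicator_const _ hA0]
    simp
  have hint2 : ∫ ω, (G * π) ω ∂P = ∫ ω in A, G ω ∂P := by
    rw [← integral_congr_ae (condExp_mul_of_stronglyMeasurable_left hG hG1i h1i),
      integral_condExp hfle, ← integral_indicator hA0]
    congr 1
    funext ω
    by_cases hω : ω ∈ A <;> simp [hω]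
  -- With `0 ≤ G - lo ≤ c`, the product `(G - lo) * (π - P.real A)` is at most `c` times the
  -- positive part of the second factor. That part lives on `B` and integrates to `P.real (A ∩ B) -
  -- P.real A * P.real B`, so the constant is `c` and not `2 * c`.
  set B : Set Ω := {ω | P.real A ≤ π ω} with hB
  have hBm : MeasurableSet[𝓖] B :=
    measurableSet_le measurable_const stronglyMeasurable_condExp.measurable
  have hint3 : ∫ ω in B, π ω ∂P = P.real (A ∩ B) := by
    rw [hπ, setIntegral_condExp hfle h1i hBm, setIntegral_indicator hA0, Set.inter_comm]
    simp
  have hBi : Integrable (B.indicator fun ω => c * (π ω - P.real A)) P :=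
    ((hπi.sub (integrable_const _)).const_mul c).indicator (hfle _ hBm)
  have hpt : ∀ ω, (G * π) ω - lo * π ω - P.real A * G ω + P.real A * lo
      ≤ B.indicator (fun ω => c * (π ω - P.real A)) ω := fun ω => by
    have h1 := (hGb ω).1
    have h2 := (hGb ω).2
    rw [Pi.mul_apply]
    by_cases hω : ω ∈ B
    · rw [Set.indicator_of_mem hω]
      have : P.real A ≤ π ω := hω
      nlinarith
    · rw [Set.indicator_of_notMem hω]
      have : π ω < P.real A := not_le.1 fun h => hω h
      nlinarith
  have i1 : Integrable (fun ω => (G * π) ω - lo * π ω) P := hGπi.sub (hπi.const_mul lo)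
  have i2 : Integrable (fun ω => (G * π) ω - lo * π ω - P.real A * G ω) P :=
    i1.sub (hGi.const_mul _)
  have hmono := integral_mono (i2.add (integrable_const _)) hBi hpt
  rw [integral_indicator (hfle _ hBm), integral_const_mul,
    integral_sub hπi.integrableOn (integrable_const _).integrableOn, hint3] at hmono
  simp only [Pi.add_apply] at hmono
  rw [integral_add i2 (integrable_const _), integral_sub i1 (hGi.const_mul _),
    integral_sub hGπi (hπi.const_mul lo), integral_const_mul, integral_const_mul, hint1, hint2]
    at hmono
  simp only [integral_const, smul_eq_mul, probReal_univ, one_mul, measureReal_restrict_apply_univ]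
    at hmono
  have hφ := hA B hBm
  have := mul_le_mul_of_nonneg_left hφ hc
  linarith

/-- An almost sure bound follows from the integrals over all events `s` of `𝓖`, and there the mixing
error is proportional to `P.real s`. -/
theorem condExp_sub_integral_le_coeff (hZ : ∀ i, Measurable (Z i)) {t : ℤ} {k : ℕ}
    (h𝓖 : 𝓖 ≤ sigmaGen Z (Set.Iic t)) {G : Ω → ℝ}
    (hG : StronglyMeasurable[sigmaGen Z (Set.Ici (t + k))] G) {lo c : ℝ}
    (hGb : ∀ ω, G ω ∈ Set.Icc lo (lo + c)) :
    ∀ᵐ ω ∂P, (P[G | 𝓖]) ω ≤ ∫ ω, G ω ∂P + c * coeff P Z k := by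
  have hle : 𝓖 ≤ m0 := h𝓖.trans (sigmaGen_le hZ _)
  have hGi : Integrable G P := Integrable.of_mem_Icc _ _
    (hG.mono (sigmaGen_le hZ _)).measurable.aemeasurable (Eventually.of_forall hGb)
  refine ae_le_of_ae_le_trim (hm := hle) (ae_le_of_forall_setIntegral_le
    (integrable_condExp.trim hle stronglyMeasurable_condExp) (integrable_const _)
    fun s hs _ => ?_)
  rw [← setIntegral_trim hle stronglyMeasurable_condExp hs,
    ← setIntegral_trim hle stronglyMeasurable_const hs, setIntegral_condExp hle hGi hs]
  have := setIntegral_sub_le_of_forall_inter (P := P) (sigmaGen_le hZ _) (hle _ hs)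
    (fun B hB => (abs_le.1 (abs_inter_sub_mul_le_coeff (P := P) hZ (h𝓖 _ hs) hB)).2) hG hGb
  rw [integral_const, measureReal_restrict_apply_univ, smul_eq_mul]
  linarith

theorem abs_condExp_sub_integral_le_coeff (hZ : ∀ i, Measurable (Z i)) {t : ℤ} {k : ℕ}
    (h𝓖 : 𝓖 ≤ sigmaGen Z (Set.Iic t)) {G : Ω → ℝ}
    (hG : StronglyMeasurable[sigmaGen Z (Set.Ici (t + k))] G) {lo c : ℝ}
    (hGb : ∀ ω, G ω ∈ Set.Icc lo (lo + c)) :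
    ∀ᵐ ω ∂P, |(P[G | 𝓖]) ω - ∫ ω, G ω ∂P| ≤ c * coeff P Z k := by
  have h1 := condExp_sub_integral_le_coeff (P := P) hZ h𝓖 hG hGb
  have h2 := condExp_sub_integral_le_coeff (P := P) hZ h𝓖 (G := -G) hG.neg (lo := -(lo + c))
    (c := c) fun ω => ⟨by simp only [Pi.neg_apply]; linarith [(hGb ω).2],
      by simp only [Pi.neg_apply]; linarith [(hGb ω).1]⟩
  filter_upwards [h1, h2, condExp_neg (μ := P) G 𝓖] with ω a1 a2 a3
  rw [a3] at a2
  simp only [Pi.neg_apply, integral_neg] at a2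
  rw [abs_le]
  constructor <;> linarith

/-- Conditional mean of a sum of functions of the future, each of range at most `c`. -/
theorem abs_condExp_sum_sub_integral_le (hZ : ∀ i, Measurable (Z i)) {a N n : ℕ} (hN : N ≤ n)
    (h𝓖 : 𝓖 ≤ sigmaGen Z (Set.Iic (a : ℤ))) {R : ℕ → Ω → ℝ}
    (hR : ∀ i : ℕ, StronglyMeasurable[sigmaGen Z (Set.Ici (i : ℤ))] (R i)) {lo c : ℝ}
    (hRb : ∀ i ω, R i ω ∈ Set.Icc lo (lo + c)) :
    ∀ᵐ ω ∂P, |(P[fun ω => ∑ i ∈ Finset.Ioc a N, R i ω | 𝓖]) ω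
      - ∫ ω, ∑ i ∈ Finset.Ioc a N, R i ω ∂P| ≤ c * coeffSum P Z n := by
  obtain ⟨ω₀⟩ : Nonempty Ω := nonempty_of_isProbabilityMeasure P
  have hc : 0 ≤ c := by linarith [(hRb 0 ω₀).1, (hRb 0 ω₀).2]
  have hRi : ∀ i, Integrable (R i) P := fun i => Integrable.of_mem_Icc _ _
    ((hR i).mono (sigmaGen_le hZ _)).measurable.aemeasurable (Eventually.of_forall (hRb i))
  have hterm : ∀ i, ∀ᵐ ω ∂P, a < i →
      |(P[R i | 𝓖]) ω - ∫ ω, R i ω ∂P| ≤ c * coeff P Z (i - a) := fun i => by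
    by_cases hi : a < i
    · have hRi' : StronglyMeasurable[sigmaGen Z (Set.Ici ((a : ℤ) + (i - a : ℕ)))] (R i) := by
        have e : (a : ℤ) + (i - a : ℕ) = i := by omega
        rw [e]; exact hR i
      exact (abs_condExp_sub_integral_le_coeff (P := P) hZ h𝓖 hRi' (hRb i)).mono fun ω h _ => h
    · exact Eventually.of_forall fun ω h => absurd h hi
  -- The lags `i - a` are distinct and lie between `1` and `n`.
  have hsum : ∑ i ∈ Finset.Ioc a N, coeff P Z (i - a) ≤ coeffSum P Z n := by
    rw [coeffSum, ← Finset.sum_image (f := fun k => coeff P Z k) (g := fun i => i - a)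
      (s := Finset.Ioc a N) (by
        intro i hi j hj hij
        simp only [Finset.coe_Ioc, Set.mem_Ioc] at hi hj
        simp only at hij
        omega)]
    refine Finset.sum_le_sum_of_subset_of_nonneg ?_ fun k _ _ => coeff_nonneg k
    intro k hk
    simp only [Finset.mem_image, Finset.mem_Ioc, Finset.mem_Icc] at hk ⊢
    obtain ⟨i, hi, rfl⟩ := hk
    omega
  have hce := condExp_finsetSum (μ := P) (s := Finset.Ioc a N) (fun i _ => hRi i) 𝓖
  have hfun : (∑ i ∈ Finset.Ioc a N, R i) = fun ω => ∑ i ∈ Finset.Ioc a N, R i ω := by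
    funext ω
    exact Finset.sum_apply _ _ _
  rw [hfun] at hce
  filter_upwards [hce, ae_all_iff.2 hterm] with ω h1 h2
  rw [h1, Finset.sum_apply, integral_finsetSum _ fun i _ => hRi i, ← Finset.sum_sub_distrib]
  calc |∑ i ∈ Finset.Ioc a N, ((P[R i | 𝓖]) ω - ∫ ω, R i ω ∂P)|
      ≤ ∑ i ∈ Finset.Ioc a N, |(P[R i | 𝓖]) ω - ∫ ω, R i ω ∂P| := Finset.abs_sum_le_sum_abs _ _
    _ ≤ ∑ i ∈ Finset.Ioc a N, c * coeff P Z (i - a) :=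
        Finset.sum_le_sum fun i hi => h2 i (Finset.mem_Ioc.1 hi).1
    _ = c * ∑ i ∈ Finset.Ioc a N, coeff P Z (i - a) := (Finset.mul_sum _ _ _).symm
    _ ≤ _ := by gcongr

end

/-! ### Expansion of block squares -/

/-- Grouping by the smaller index leaves one summand per time `i`, depending only on times from `i`
on, so the mixing coefficient of each lag is paid once. -/
theorem sq_sum_Ioc_eq (y : ℕ → ℝ) {a b : ℕ} (hab : a ≤ b) :
    (∑ i ∈ Finset.Ioc a b, y i) ^ 2
      = ∑ i ∈ Finset.Ioc a b, (y i ^ 2 + 2 * y i * ∑ j ∈ Finset.Ioc i b, y j) := by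
  induction b, hab using Nat.le_induction with
  | base => simp
  | succ b hab ih =>
    rw [Finset.sum_Ioc_succ_top hab, Finset.sum_Ioc_succ_top hab, add_sq, ih, Finset.Ioc_self,
      Finset.sum_empty, mul_zero, add_zero]
    have : ∀ i ∈ Finset.Ioc a b, y i ^ 2 + 2 * y i * ∑ j ∈ Finset.Ioc i (b + 1), y j
        = (y i ^ 2 + 2 * y i * ∑ j ∈ Finset.Ioc i b, y j) + 2 * y (b + 1) * y i := fun i hi => by
      rw [Finset.sum_Ioc_succ_top (Finset.mem_Ioc.1 hi).2]
      ring
    rw [Finset.sum_congr rfl this, Finset.sum_add_distrib (f := fun i =>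
      y i ^ 2 + 2 * y i * ∑ j ∈ Finset.Ioc i b, y j), ← Finset.mul_sum]
    ring

theorem sum_Ioc_blocks (x : ℕ → ℝ) (L : ℕ) {j N : ℕ} (hj : j ≤ N) :
    ∑ k ∈ Finset.Ico j N, ∑ i ∈ Finset.Ioc (k * L) ((k + 1) * L), x i
      = ∑ i ∈ Finset.Ioc (j * L) (N * L), x i := by
  induction N, hj using Nat.le_induction with
  | base => simp
  | succ N hj ih =>
    rw [Finset.sum_Ico_succ_top hj, ih]
    exact Finset.sum_Ioc_consecutive x (Nat.mul_le_mul_right L hj)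
      (Nat.mul_le_mul_right L N.le_succ)

/-- The product `y * T` ranges from `-p q t` to `t` times the larger of `p²` and `q²`, a width of at
most `t`. Used with `t = L - 1`, the total width `2 * L` becomes `2 / L` after normalization. -/
theorem sq_add_two_mul_mem_Icc {p q y T t : ℝ} (hp : 0 ≤ p) (hq : 0 ≤ q) (hpq : p + q = 1)
    (ht : 0 ≤ t) (hy : y ∈ Set.Icc (-q) p) (hT : T ∈ Set.Icc (-(t * q)) (t * p)) :
    y ^ 2 + 2 * y * T ∈ Set.Icc (-(2 * p * q * t)) (-(2 * p * q * t) + 2 * (t + 1)) := by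
  obtain ⟨h1, h2⟩ := hy
  obtain ⟨h3, h4⟩ := hT
  have hpt : 0 ≤ p * t := by positivity
  have hqt : 0 ≤ q * t := by positivity
  have hy2 : y ^ 2 ≤ 1 := by nlinarith
  have e1 : p * q * t + p * p * t = p * t := by linear_combination p * t * hpq
  have e2 : p * q * t + q * q * t = q * t := by linear_combination q * t * hpq
  have e3 : p * t + q * t = t := by linear_combination t * hpq
  rcases le_total 0 y with hy0 | hy0
  · have a1 : -(p * (t * q)) ≤ y * T := by
      have b1 : y * (-(t * q)) ≤ y * T := by gcongr
      have b2 : y * (t * q) ≤ p * (t * q) := by gcongr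
      linarith
    have a2 : y * T ≤ p * (t * p) :=
      (mul_le_mul_of_nonneg_left h4 hy0).trans (by gcongr)
    exact ⟨by nlinarith [sq_nonneg y], by nlinarith⟩
  · have a1 : -(q * (t * p)) ≤ y * T := by
      have b1 : y * (t * p) ≤ y * T := mul_le_mul_of_nonpos_left h4 hy0
      have b2 : -y * (t * p) ≤ q * (t * p) := by gcongr; linarith
      linarith
    have a2 : y * T ≤ q * (t * q) := by
      have b1 : y * T ≤ y * (-(t * q)) := mul_le_mul_of_nonpos_left h3 hy0
      have b2 : -y * (t * q) ≤ q * (t * q) := by gcongr; linarith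
      linarith
    exact ⟨by nlinarith [sq_nonneg y], by nlinarith⟩

/-! ### Block means of a φ-mixing process -/

section

variable {Ω S : Type*} [m0 : MeasurableSpace Ω] [MeasurableSpace S] {P : Measure Ω}
  {Z : ℤ → Ω → S}

/-- The filtration of the blocks of length `L`: at time `j` the variables `Z 1, …, Z (j L)` are
known. -/
def blockFiltration (hZ : ∀ i, Measurable (Z i)) (L : ℕ) : Filtration ℕ m0 where
  seq j := sigmaGen Z (Set.Icc 1 ((j * L : ℕ) : ℤ))
  mono' i j hij := sigmaGen_mono (Set.Icc_subset_Icc_right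
    (by exact_mod_cast Nat.mul_le_mul_right L hij))
  le' _ := sigmaGen_le hZ _

theorem blockFiltration_zero (hZ : ∀ i, Measurable (Z i)) (L : ℕ) :
    blockFiltration hZ L 0 = ⊥ := by
  change sigmaGen Z (Set.Icc 1 ((0 * L : ℕ) : ℤ)) = ⊥
  simp [sigmaGen]

/-- The normalized sum of `y (Z i)` over the block `kL < i ≤ (k + 1) L`. -/
def blockMean (Z : ℤ → Ω → S) (y : S → ℝ) (L k : ℕ) (ω : Ω) : ℝ :=
  (1 / (L : ℝ)) * ∑ i ∈ Finset.Ioc (k * L) ((k + 1) * L), y (Z (i : ℤ) ω)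

theorem sum_mem_Icc_of_forall_mem {p q : ℝ} (s : Finset ℕ) {x : ℕ → ℝ}
    (hx : ∀ i, x i ∈ Set.Icc (-q) p) :
    ∑ i ∈ s, x i ∈ Set.Icc (-(s.card * q)) (s.card * p) := by
  constructor
  · have := Finset.card_nsmul_le_sum s x (-q) fun i _ => (hx i).1
    rw [nsmul_eq_mul] at this
    linarith
  · have := Finset.sum_le_card_nsmul s x p fun i _ => (hx i).2
    rwa [nsmul_eq_mul] at this

variable [IsProbabilityMeasure P]

/-- Empirical Bernstein inequality for the block sums of a φ-mixing sequence. -/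
theorem empirical_bernstein_blockMean (hZ : ∀ i, Measurable (Z i)) {y : S → ℝ} (hy : Measurable y)
    {p q : ℝ} (hp : 0 ≤ p) (hq : 0 ≤ q) (hpq : p + q = 1) (hyb : ∀ z, y z ∈ Set.Icc (-q) p)
    (hy0 : ∀ i, ∫ ω, y (Z i ω) ∂P = 0) {L N n : ℕ} (hL : 0 < L) (hn : N * L ≤ n) {u : ℝ}
    (hu : 0 < u) (huN : 2 * u < N) :
    1 - 3 * Real.exp (-u) ≤ P.real {ω | |∑ k ∈ Finset.range N, blockMean Z y L k ω| ≤
      √(2 * u) * √(∑ k ∈ Finset.range N, blockMean Z y L k ω ^ 2)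
        + 4 * √(2 * u) * (coeffSum P Z n / L) * √N + (3.15 + 2 * (coeffSum P Z n / L)) * u} := by
  have hL0 : (0 : ℝ) < L := by exact_mod_cast hL
  have hYm : ∀ {s : Set ℤ} {i : ℤ}, i ∈ s →
      StronglyMeasurable[sigmaGen Z s] fun ω => y (Z i ω) := fun hi =>
    stronglyMeasurable_comp_sigmaGen hy hi
  have hYi : ∀ i, Integrable (fun ω => y (Z i ω)) P := fun i => Integrable.of_mem_Icc _ _
    (hy.comp (hZ i)).aemeasurable (Eventually.of_forall fun ω => hyb _)
  have hm : ∀ k, StronglyMeasurable[blockFiltration hZ L (k + 1)] (blockMean Z y L k) := by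
    intro k
    refine StronglyMeasurable.const_mul (Finset.stronglyMeasurable_fun_sum _ fun i hi => ?_) _
    refine hYm ?_
    rw [Finset.mem_Ioc] at hi
    rw [Set.mem_Icc]
    exact ⟨by omega, by exact_mod_cast hi.2⟩
  have hcard : ∀ k, (Finset.Ioc (k * L) ((k + 1) * L)).card = L := fun k => by
    rw [Nat.card_Ioc, add_mul, one_mul, Nat.add_sub_cancel_left]
  have hb : ∀ k ω, blockMean Z y L k ω ∈ Set.Icc (-q) p := by
    intro k ω
    have h1 := sum_mem_Icc_of_forall_mem (Finset.Ioc (k * L) ((k + 1) * L))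
      (x := fun i : ℕ => y (Z (i : ℤ) ω)) fun i => hyb _
    rw [hcard] at h1
    rw [blockMean, one_div, ← div_eq_inv_mul, Set.mem_Icc, le_div_iff₀ hL0, div_le_iff₀ hL0]
    exact ⟨by linarith [h1.1], by linarith [h1.2]⟩
  have h0 : ∀ k, ∫ ω, blockMean Z y L k ω ∂P = 0 := by
    intro k
    simp only [blockMean]
    rw [integral_const_mul, integral_finsetSum _ fun i _ => hYi _]
    simp [hy0]
  have hWi : ∀ k, Integrable (fun ω => blockMean Z y L k ω ^ 2) P := fun k => by
    refine Integrable.of_bound (C := 1)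
      (((hm k).mono ((blockFiltration hZ L).le _)).aestronglyMeasurable.pow 2)
      (Eventually.of_forall fun ω => ?_)
    rw [Real.norm_of_nonneg (sq_nonneg _)]
    nlinarith [(hb k ω).1, (hb k ω).2]
  have hpast : ∀ j, (blockFiltration hZ L) j ≤ sigmaGen Z (Set.Iic ((j * L : ℕ) : ℤ)) := fun j =>
    sigmaGen_mono fun i hi => hi.2
  refine empirical_bernstein_of_corrector_bounds (blockFiltration_zero hZ L) hp hq hpq hm hb h0
    (div_nonneg (coeffSum_nonneg n) hL0.le) ?_ ?_ hu huN
  · intro j hj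
    have h1 := abs_condExp_sum_sub_integral_le (P := P) hZ hn (hpast j)
      (R := fun i ω => 1 / (L : ℝ) * y (Z i ω)) (lo := 1 / (L : ℝ) * -q) (c := 1 / (L : ℝ))
      (fun i => (hYm Set.self_mem_Ici).const_mul _) fun i ω =>
        ⟨mul_le_mul_of_nonneg_left (hyb _).1 (by positivity), by
          rw [show 1 / (L : ℝ) * -q + 1 / (L : ℝ) = 1 / (L : ℝ) * p by
            rw [show p = 1 - q by linarith]; ring]
          exact mul_le_mul_of_nonneg_left (hyb _).2 (by positivity)⟩
    have hfun : (fun ω => ∑ k ∈ Finset.Ico j N, blockMean Z y L k ω)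
        = fun ω => ∑ i ∈ Finset.Ioc (j * L) (N * L), 1 / (L : ℝ) * y (Z i ω) := by
      funext ω
      rw [← sum_Ioc_blocks (fun i => 1 / (L : ℝ) * y (Z i ω)) L hj]
      simp only [blockMean, Finset.mul_sum]
    have hint : ∫ ω, ∑ i ∈ Finset.Ioc (j * L) (N * L), 1 / (L : ℝ) * y (Z i ω) ∂P = 0 := by
      rw [integral_finsetSum _ fun i _ => (hYi _).const_mul _]
      simp [integral_const_mul, hy0]
    rw [hint, ← hfun] at h1
    filter_upwards [h1] with ω h2
    rw [sub_zero, one_div_mul_eq_div] at h2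
    exact h2
  · intro j hj
    -- `e i` is the end of the block containing `i`, namely `i` rounded up to a multiple of `L`; at
    -- most `L - 1` indices of the block follow `i`.
    set e : ℕ → ℕ := fun i => (i + (L - 1)) / L * L with he
    have hei : ∀ i : ℕ, ((Finset.Ioc i (e i)).card : ℝ) ≤ L - 1 := fun i => by
      have h1 : (Finset.Ioc i (e i)).card + 1 ≤ L := by
        rw [Nat.card_Ioc]
        have : e i ≤ i + (L - 1) := Nat.div_mul_le_self _ _
        omega
      have : ((Finset.Ioc i (e i)).card : ℝ) + 1 ≤ L := by exact_mod_cast h1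
      linarith
    have h1 := abs_condExp_sum_sub_integral_le (P := P) hZ hn (hpast j)
      (R := fun i ω => (1 / (L : ℝ)) ^ 2 * (y (Z i ω) ^ 2
        + 2 * y (Z i ω) * ∑ l ∈ Finset.Ioc i (e i), y (Z (l : ℤ) ω)))
      (lo := (1 / (L : ℝ)) ^ 2 * -(2 * p * q * (L - 1))) (c := 2 / (L : ℝ))
      (fun i => StronglyMeasurable.const_mul (((hYm Set.self_mem_Ici).pow 2).add
        (((hYm Set.self_mem_Ici).const_mul 2).mul
          (Finset.stronglyMeasurable_fun_sum _ fun l hl => hYm (by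
            have := (Finset.mem_Ioc.1 hl).1
            rw [Set.mem_Ici]
            exact_mod_cast this.le)))) _)
      (fun i ω => by
        have hT := sum_mem_Icc_of_forall_mem (Finset.Ioc i (e i))
          (x := fun l : ℕ => y (Z (l : ℤ) ω)) fun l => hyb _
        have hT' : ∑ l ∈ Finset.Ioc i (e i), y (Z (l : ℤ) ω)
            ∈ Set.Icc (-(((L : ℝ) - 1) * q)) (((L : ℝ) - 1) * p) := by
          have b1 := mul_le_mul_of_nonneg_right (hei i) hq
          have b2 := mul_le_mul_of_nonneg_right (hei i) hp
          exact ⟨by linarith [hT.1], by linarith [hT.2]⟩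
        have h3 := sq_add_two_mul_mem_Icc hp hq hpq
          (sub_nonneg.2 (by exact_mod_cast hL : (1 : ℝ) ≤ L)) (hyb (Z i ω)) hT'
        refine ⟨mul_le_mul_of_nonneg_left h3.1 (by positivity), ?_⟩
        refine (mul_le_mul_of_nonneg_left h3.2 (by positivity)).trans (le_of_eq ?_)
        field_simp
        ring)
    have hblock : ∀ k ω, blockMean Z y L k ω ^ 2 = ∑ i ∈ Finset.Ioc (k * L) ((k + 1) * L),
        (1 / (L : ℝ)) ^ 2 * (y (Z i ω) ^ 2
          + 2 * y (Z i ω) * ∑ l ∈ Finset.Ioc i (e i), y (Z (l : ℤ) ω)) := fun k ω => by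
      rw [blockMean, mul_pow, sq_sum_Ioc_eq (fun i : ℕ => y (Z (i : ℤ) ω))
        (Nat.mul_le_mul_right L k.le_succ), Finset.mul_sum]
      refine Finset.sum_congr rfl fun i hi => ?_
      rw [Finset.mem_Ioc] at hi
      have : (i + (L - 1)) / L = k + 1 := by
        rw [Nat.div_eq_iff hL]
        have := add_mul k 1 L
        constructor <;> omega
      simp only [he, this]
    have hfun : (fun ω => ∑ i ∈ Finset.Ioc (j * L) (N * L), (1 / (L : ℝ)) ^ 2 * (y (Z i ω) ^ 2
          + 2 * y (Z i ω) * ∑ l ∈ Finset.Ioc i (e i), y (Z (l : ℤ) ω)))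
        = fun ω => ∑ k ∈ Finset.Ico j N, blockMean Z y L k ω ^ 2 := by
      funext ω
      rw [← sum_Ioc_blocks _ L hj]
      exact Finset.sum_congr rfl fun k _ => (hblock k ω).symm
    rw [hfun, integral_finsetSum _ fun k _ => hWi k] at h1
    have h2 := condExp_sub (μ := P) (integrable_finsetSum (Finset.Ico j N) fun k _ => hWi k)
      (integrable_const (∑ k ∈ Finset.Ico j N, ∫ ω, blockMean Z y L k ω ^ 2 ∂P))
      (blockFiltration hZ L j)
    rw [condExp_const ((blockFiltration hZ L).le j)] at h2
    have hfun2 : (fun ω => ∑ k ∈ Finset.Ico j N, (blockMean Z y L k ω ^ 2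
          - ∫ ω', blockMean Z y L k ω' ^ 2 ∂P))
        = (fun ω => ∑ k ∈ Finset.Ico j N, blockMean Z y L k ω ^ 2)
          - fun _ => ∑ k ∈ Finset.Ico j N, ∫ ω, blockMean Z y L k ω ^ 2 ∂P := by
      funext ω
      rw [Pi.sub_apply, Finset.sum_sub_distrib]
    rw [hfun2]
    filter_upwards [h1, h2] with ω a1 a2
    rw [a2, Pi.sub_apply]
    refine a1.trans (le_of_eq ?_)
    ring

end

/-! ### From block sums to the sample average -/

theorem sum_block_eq (x : ℤ → ℝ) (c : ℝ) (L k : ℕ) :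
    ∑ i ∈ block L (k + 1), (x (i : ℤ) - c)
      = ∑ i ∈ Finset.Ioc (k * L) ((k + 1) * L), (x (i : ℤ) - c) := by
  rw [block, Nat.add_sub_cancel, Finset.Icc_add_one_left_eq_Ioc]

/-- From a deviation bound for the centred block sums to one for the average. -/
theorem abs_avg_sub_le {x : ℤ → ℝ} {n L N : ℕ} (hn : 1 ≤ n) (hL : 0 < L) (hN : N = numBlocks n L)
    {μ a b Φ ξ δ u : ℝ} (hx : ∀ i, x i ∈ Set.Icc a b) (hμ : μ ∈ Set.Icc a b)
    (hu : u = Real.log (1 / δ)) (hu0 : 0 < u) (huN : 2 * u < N)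
    (hD : |∑ i ∈ Finset.Ioc 0 (N * L), (x (i : ℤ) - μ)| ≤
      √(2 * u) * √(∑ k ∈ Finset.range N,
          (∑ i ∈ Finset.Ioc (k * L) ((k + 1) * L), (x (i : ℤ) - μ)) ^ 2)
        + 4 * √(2 * u) * Φ * (b - a) * √N + (3.15 * L + 2 * Φ) * (b - a) * u) :
    |avg x n - μ| ≤ nuTilde N δ * (termA (blockVar x n L) (b - a) Φ ξ δ n N
      + termB (b - a) Φ δ n L) + ((n : ℝ) - N * L) / n * (b - a) := by
  have hn0 : (0 : ℝ) < n := by exact_mod_cast hn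
  have hN0 : (0 : ℝ) < N := by linarith
  have hL0 : (0 : ℝ) < L := by exact_mod_cast hL
  have hr : 0 ≤ b - a := by linarith [hμ.1, hμ.2]
  have hNL : N * L ≤ n := by rw [hN]; exact Nat.div_mul_le_self n L
  set s : ℕ → ℝ := fun k => ∑ i ∈ Finset.Ioc (k * L) ((k + 1) * L), (x (i : ℤ) - μ) with hs
  set D := ∑ i ∈ Finset.Ioc 0 (N * L), (x (i : ℤ) - μ) with hDdef
  have hDs : ∑ k ∈ Finset.range N, s k = D := by
    have := sum_Ioc_blocks (fun i => x (i : ℤ) - μ) L (Nat.zero_le N)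
    rw [zero_mul, ← Finset.range_eq_Ico] at this
    exact this
  set H := avg x (N * L) with hH
  have hHD : (N : ℝ) * L * (H - μ) = D := by
    have hne : (N : ℝ) * L ≠ 0 := by positivity
    rw [hH, avg, hDdef, Finset.sum_sub_distrib, Finset.sum_const, Nat.card_Ioc, nsmul_eq_mul]
    have e : Finset.Icc 1 (N * L) = Finset.Ioc 0 (N * L) := rfl
    rw [e]
    push_cast
    field_simp
    simp
    ring
  have hsH : ∀ k, ∑ i ∈ block L (k + 1), (x (i : ℤ) - H) = s k - D / N := fun k => by
    have e : D / N = L * (H - μ) := by rw [← hHD]; field_simp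
    have hc : (Finset.Ioc (k * L) ((k + 1) * L)).card = L := by
      rw [Nat.card_Ioc, add_mul, one_mul, Nat.add_sub_cancel_left]
    rw [sum_block_eq, e, hs]
    simp only [Finset.sum_sub_distrib, Finset.sum_const, hc, nsmul_eq_mul]
    ring
  set V := blockVar x n L with hV
  have hnV : n * V = ∑ k ∈ Finset.range N, s k ^ 2 - D ^ 2 / N := by
    have e : ∑ j ∈ Finset.Icc 1 N, (∑ i ∈ block L j, (x (i : ℤ) - H)) ^ 2
        = ∑ k ∈ Finset.range N, (s k - D / N) ^ 2 := by
      rw [← Finset.Ico_add_one_right_eq_Icc, Finset.sum_Ico_eq_sum_range, Nat.add_sub_cancel]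
      refine Finset.sum_congr rfl fun k _ => ?_
      rw [add_comm 1 k, hsH]
    rw [hV, blockVar, ← hN, ← hH, e]
    have e2 : ∑ k ∈ Finset.range N, (s k - D / N) ^ 2 = ∑ k ∈ Finset.range N, s k ^ 2 - D ^ 2 / N := by
      simp only [sub_sq, Finset.sum_add_distrib, Finset.sum_sub_distrib, Finset.sum_const,
        Finset.card_range, nsmul_eq_mul]
      rw [← Finset.sum_mul, ← Finset.mul_sum, hDs]
      field_simp
      ring
    rw [e2]
    field_simp
  have hV0 : 0 ≤ V := by
    rw [hV, blockVar]
    exact mul_nonneg (by positivity) (Finset.sum_nonneg fun j _ => sq_nonneg _)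
  -- Subadditivity of the square root separates the effect of centring at the empirical mean;
  -- multiplied by `√(2 * u)`, the extra term is `t * |D|` with `t < 1`.
  have hQ : √(∑ k ∈ Finset.range N, s k ^ 2) ≤ √(n * V) + |D| / √N := by
    rw [show ∑ k ∈ Finset.range N, s k ^ 2 = n * V + D ^ 2 / N by linarith]
    refine Real.sqrt_le_iff.2 ⟨by positivity, ?_⟩
    rw [add_sq, div_pow, sq_abs, Real.sq_sqrt (by positivity), Real.sq_sqrt hN0.le]
    have : 0 ≤ 2 * √(n * V) * (|D| / √N) := by positivity
    linarith
  set t := √(2 * u / N) with ht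
  have ht1 : t < 1 := by
    rw [ht, Real.sqrt_lt' one_pos, one_pow, div_lt_one hN0]
    exact huN
  have htN : √(2 * u) * (|D| / √N) = t * |D| := by
    rw [ht, Real.sqrt_div (by positivity)]
    ring
  have hν : nuTilde N δ = (1 - t)⁻¹ := by rw [nuTilde, ht, hu]
  have hA1 : √(2 * u * (1 / (n : ℝ)) * V) = √(2 * u) * √(n * V) / n := by
    rw [← Real.sqrt_mul (by positivity), show 2 * u * (1 / (n : ℝ)) * V
      = 2 * u * (n * V) / (n : ℝ) ^ 2 by field_simp, Real.sqrt_div (by positivity),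
      Real.sqrt_sq hn0.le]
  have hA2 : √(2 * u * N / (n : ℝ) ^ 2) = √(2 * u) * √N / n := by
    rw [Real.sqrt_div (by positivity), Real.sqrt_sq hn0.le, Real.sqrt_mul (by positivity)]
  have hmain : |D| / n ≤ nuTilde N δ * (termA V (b - a) Φ ξ δ n N + termB (b - a) Φ δ n L) := by
    rw [hν, ← div_eq_inv_mul, le_div_iff₀ (by linarith), termA, termB, ← hu, hA1, hA2]
    have h1 : |D| * (1 - t) ≤ √(2 * u) * √(n * V) + 4 * √(2 * u) * Φ * (b - a) * √N
        + (3.15 * L + 2 * Φ) * (b - a) * u := by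
      have := mul_le_mul_of_nonneg_left hQ (Real.sqrt_nonneg (2 * u))
      rw [mul_add, htN] at this
      linarith
    -- The `ξ` term only enlarges the bound; a real square root is nonnegative whatever the sign of
    -- `ξ`.
    have h2 : 0 ≤ √(2 * u * ξ / (n : ℝ) ^ 2) := Real.sqrt_nonneg _
    have h3 : |D| / n * (1 - t) ≤ (√(2 * u) * √(n * V) + 4 * √(2 * u) * Φ * (b - a) * √N
        + (3.15 * L + 2 * Φ) * (b - a) * u) / n := by
      rw [div_mul_eq_mul_div]
      gcongr
    refine h3.trans ?_
    have h4 : (√(2 * u) * √(n * V) + 4 * √(2 * u) * Φ * (b - a) * √N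
        + (3.15 * L + 2 * Φ) * (b - a) * u) / n = √(2 * u) * √(n * V) / n
        + 4 * (b - a) * Φ * (√(2 * u) * √N / n) + (3.15 * L + 2 * Φ) * (b - a) * u / n := by ring
    linarith
  have hrest : |∑ i ∈ Finset.Ioc (N * L) n, (x (i : ℤ) - μ)| ≤ ((n : ℝ) - N * L) * (b - a) := by
    refine (Finset.abs_sum_le_sum_abs _ _).trans ?_
    refine (Finset.sum_le_card_nsmul _ _ (b - a) fun i _ => ?_).trans (le_of_eq ?_)
    · rw [abs_le]
      exact ⟨by linarith [(hx i).1, hμ.2], by linarith [(hx i).2, hμ.1]⟩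
    · rw [Nat.card_Ioc, nsmul_eq_mul, Nat.cast_sub hNL]
      push_cast
      ring
  have havg : avg x n - μ = (D + ∑ i ∈ Finset.Ioc (N * L) n, (x (i : ℤ) - μ)) / n := by
    rw [hDdef, Finset.sum_Ioc_consecutive _ (Nat.zero_le _) hNL, Finset.sum_sub_distrib,
      Finset.sum_const, Nat.card_Ioc, nsmul_eq_mul, avg]
    have e : Finset.Icc 1 n = Finset.Ioc 0 n := rfl
    rw [e, Nat.sub_zero]
    field_simp
  rw [havg, abs_div, abs_of_pos hn0]
  calc |D + ∑ i ∈ Finset.Ioc (N * L) n, (x (i : ℤ) - μ)| / n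
      ≤ (|D| + ((n : ℝ) - N * L) * (b - a)) / n := by
        gcongr
        exact (abs_add_le _ _).trans (by gcongr)
    _ = |D| / n + ((n : ℝ) - N * L) / n * (b - a) := by ring
    _ ≤ _ := by gcongr

end PhiMixing

end

/-! ### The empirical Bernstein bound -/

theorem theorem2 {Ω S : Type*} [MeasurableSpace Ω] [MeasurableSpace S]
    (P : Measure Ω) [IsProbabilityMeasure P]
    (Z : ℤ → Ω → S) (hZ : ∀ i, Measurable (Z i)) (hmix : PhiMixing.IsPhiMixing P Z)
    -- the functions `h_n`, with values in `[a_n, b_n]` and common mean `μ_n`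
    (h : ℕ → S → ℝ) (hh : ∀ n, Measurable (h n))
    (a b μ : ℕ → ℝ) (hab : ∀ n z, h n z ∈ Set.Icc (a n) (b n))
    (hμ : ∀ n i, ∫ ω, h n (Z i ω) ∂P = μ n)
    -- the block lengths are the integer parts `[l_n]`
    (l : ℕ → ℝ) (hl_pos : ∀ n, 0 < l n) (hl_top : Tendsto l atTop atTop)
    (hl_o : l =o[atTop] fun n : ℕ => √(n : ℝ))
    -- `ξ_n` decreases to `0`
    (ξ : ℕ → ℝ) (hξ_anti : Antitone ξ) (hξ_lim : Tendsto ξ atTop (𝓝 0))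
    (δ : ℝ) (hδ : 0 < δ) (n : ℕ) (hn : 1 ≤ n)
    -- the factor `1 - √(2 log(1/δ) / m)` is positive
    (hm : 2 * Real.log (1 / δ) < (PhiMixing.numBlocks n ⌊l n⌋₊ : ℝ)) :
    1 - 3 * δ ≤ P.real {ω |
      |PhiMixing.avg (fun i => h n (Z i ω)) n - μ n| ≤
        PhiMixing.nuTilde (PhiMixing.numBlocks n ⌊l n⌋₊) δ *
            (PhiMixing.termA (PhiMixing.blockVar (fun i => h n (Z i ω)) n ⌊l n⌋₊)
                (b n - a n) (PhiMixing.coeffSum P Z n) (ξ n) δ n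
                (PhiMixing.numBlocks n ⌊l n⌋₊)
              + PhiMixing.termB (b n - a n) (PhiMixing.coeffSum P Z n) δ n ⌊l n⌋₊)
          + ((n : ℝ) - PhiMixing.numBlocks n ⌊l n⌋₊ * ⌊l n⌋₊) / n * (b n - a n)} := by
  -- For `δ ≥ 1/3` the claimed probability is at most zero; otherwise `log (1 / δ) > 0`.
  rcases le_or_gt (1 / 3) δ with hδ3 | hδ3
  · exact le_trans (by linarith) measureReal_nonneg
  set L := ⌊l n⌋₊ with hL
  set N := PhiMixing.numBlocks n L with hN
  obtain ⟨u, hu⟩ : ∃ u, u = Real.log (1 / δ) := ⟨_, rfl⟩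
  have hu0 : 0 < u := by
    rw [hu]
    refine Real.log_pos ?_
    rw [lt_div_iff₀ hδ]
    linarith
  have hexp : Real.exp (-u) = δ := by
    rw [hu, one_div, Real.log_inv, neg_neg, Real.exp_log hδ]
  rw [← hu] at hm
  have hL0 : 0 < L := by
    rcases Nat.eq_zero_or_pos L with h0 | h0
    · rw [hN, h0, PhiMixing.numBlocks, Nat.div_zero, Nat.cast_zero] at hm
      linarith
    · exact h0
  have hNL : N * L ≤ n := Nat.div_mul_le_self n L
  obtain ⟨ω₀⟩ : Nonempty Ω := nonempty_of_isProbabilityMeasure P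
  have hint : ∀ i, Integrable (fun ω => h n (Z i ω)) P := fun i => Integrable.of_mem_Icc _ _
    ((hh n).comp (hZ i)).aemeasurable (Eventually.of_forall fun ω => hab n _)
  have hμm : μ n ∈ Set.Icc (a n) (b n) := by
    rw [← hμ n 0]
    constructor
    · have := integral_mono (integrable_const (a n)) (hint 0) fun ω => (hab n _).1
      simpa using this
    · have := integral_mono (hint 0) (integrable_const (b n)) fun ω => (hab n _).2
      simpa using this
  have hdet : ∀ ω, |∑ i ∈ Finset.Ioc 0 (N * L), (h n (Z (i : ℤ) ω) - μ n)| ≤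
      √(2 * u) * √(∑ k ∈ Finset.range N,
          (∑ i ∈ Finset.Ioc (k * L) ((k + 1) * L), (h n (Z (i : ℤ) ω) - μ n)) ^ 2)
        + 4 * √(2 * u) * PhiMixing.coeffSum P Z n * (b n - a n) * √N
        + (3.15 * L + 2 * PhiMixing.coeffSum P Z n) * (b n - a n) * u → _ := fun ω =>
    PhiMixing.abs_avg_sub_le (x := fun i => h n (Z i ω)) (ξ := ξ n) hn hL0 hN (fun i => hab n _)
      hμm hu hu0 hm
  -- A zero range cannot be normalized to one, but then `h n` is constantly `μ n` and both sides of
  -- the block bound vanish.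
  rcases (sub_nonneg.2 (hμm.1.trans hμm.2)).eq_or_lt with hr | hr
  · have hz : ∀ i ω, h n (Z i ω) - μ n = 0 := fun i ω => by
      have := hab n (Z i ω)
      linarith [this.1, this.2, hμm.1, hμm.2]
    refine le_trans (by linarith) (le_of_eq (probReal_univ (μ := P)).symm) |>.trans
      (measureReal_mono fun ω _ => hdet ω ?_)
    simp [hz, ← hr]
  · set r := b n - a n with hrdef
    have key := PhiMixing.empirical_bernstein_blockMean (P := P) hZ
      (y := fun z => (h n z - μ n) / r) (((hh n).sub_const _).div_const _)
      (p := (b n - μ n) / r) (q := (μ n - a n) / r)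
      (div_nonneg (by linarith [hμm.2]) hr.le) (div_nonneg (by linarith [hμm.1]) hr.le)
      (by rw [← add_div, hrdef, sub_add_sub_cancel, div_self]; exact hr.ne')
      (fun z => ⟨by rw [← neg_div]; gcongr; linarith [(hab n z).1],
        by gcongr; exact (hab n z).2⟩)
      (fun i => by
        rw [integral_div, integral_sub (hint i) (integrable_const _), hμ]
        simp) hL0 hNL hu0 hm
    rw [hexp] at key
    refine key.trans (measureReal_mono fun ω hω => hdet ω ?_)
    rw [Set.mem_ofPred_eq] at hω
    have hLr : (0 : ℝ) < L * r := mul_pos (by exact_mod_cast hL0) hr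
    have hscale : ∀ k, ∑ i ∈ Finset.Ioc (k * L) ((k + 1) * L), (h n (Z (i : ℤ) ω) - μ n)
        = L * r * PhiMixing.blockMean Z (fun z => (h n z - μ n) / r) L k ω := fun k => by
      rw [PhiMixing.blockMean, ← Finset.sum_div]
      have : (L : ℝ) ≠ 0 := by positivity
      field_simp
    have hsum : ∑ i ∈ Finset.Ioc 0 (N * L), (h n (Z (i : ℤ) ω) - μ n)
        = L * r * ∑ k ∈ Finset.range N,
          PhiMixing.blockMean Z (fun z => (h n z - μ n) / r) L k ω := by
      have e := PhiMixing.sum_Ioc_blocks (fun i => h n (Z (i : ℤ) ω) - μ n) L (Nat.zero_le N)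
      rw [zero_mul, ← Finset.range_eq_Ico] at e
      rw [← e, Finset.mul_sum]
      exact Finset.sum_congr rfl fun k _ => hscale k
    rw [hsum, abs_mul, abs_of_pos hLr]
    refine (mul_le_mul_of_nonneg_left hω hLr.le).trans (le_of_eq ?_)
    simp only [hscale, mul_pow (L * r : ℝ)]
    rw [← Finset.mul_sum, Real.sqrt_mul (sq_nonneg _), Real.sqrt_sq hLr.le]
    field_simp
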